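/- Conventions. A Cartesian category is a category with chosen finite products; composition is written in diagrammatic order, $\pi_0,\pi_1$ are the projections, $!$ denotes a map to the terminal object $1$. If $(A,+,0)$ is a commutative monoid in a Cartesian category and $f,g:X\to A$, then $f+g:=\langle f,g\rangle +$, and $0:X\to A$ also denotes $!\,0$. "Additive and symmetric" maps are understood with respect to this addition of maps. A *generalized Cartesian differential category* is a Cartesian category with a commutative monoid $L(X)=(L_0(X),+_X,0_X)$ for each object $X$, such that $$L(L_0(X))=L(X),\qquad L(X\times Y)=L(X)\times L(Y),\qquad L(1)=1,$$ and a map $D[f]:L_0(X)\times X\to L_0(Y)$ for each map $f:X\to Y$, such that - [CD.1] $D[+_X]=\pi_0\,+_X$ and $D[0_X]=\pi_0\,0_X$; - [CD.2] $\langle a+b,c\rangle D[f]=\langle a,c\rangle D[f]+\langle b,c\rangle D[f]$ and $\langle 0,a\rangle D[f]=0$; - [CD.3] $D[\pi_0]=\pi_0\pi_0$ and $D[\pi_1]=\pi_0\pi_1$; - [CD.4] $D[\langle f,g\rangle]=\langle D[f],D[g]\rangle$; - [CD.5] $D[fg]=\langle D[f],\pi_1 f\rangle D[g]$; - [CD.6]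 $\langle\langle a,0\rangle,\langle c,d\rangle\rangle D[D[f]]=\langle a,d\rangle D[f]$; - [CD.7] $\langle\langle 0,b\rangle,\langle c,d\rangle\rangle D[D[f]]=\langle\langle 0,c\rangle,\langle b,d\rangle\rangle D[D[f]]$. For a Cartesian category $\mathbb X$, the category $\mathrm{Faà}(\mathbb X)$ has as objects the pairs $((A,+,0),X)$ of a commutative monoid and an object of $\mathbb X$. A map $((A,+,0),X)\to((B,+,0),Y)$ is a sequence $(f_*,f_1,f_2,\dots)$ with $f_*:X\to Y$ and, for $n\ge 1$, $f_n:A^n\times X\to B$ additive and symmetric in its first $n$ variables. Composition is $(fg)_*=f_*g_*$ and $$(fg)_n(a_1,\dots,a_n,x)=\sum_{\{B_1,\dots,B_k\}} g_k\big(f_{|B_1|}((a_i)_{i\in B_1},x),\dots,f_{|B_k|}((a_i)_{i\in B_k},x),f_*(x)\big),$$ the sum being over all partitions $\{B_1,\dots,B_k\}$ of $\{1,\dots,n\}$; identities are $(1,\pi_0,0,0,\dots)$. The product of $((A,+,0),X)$ and $((B,+,0),Y)$ is $((A\times B,+,0),X\times Y)$, with componentwise addition and projections $(\pi_i,\pi_0\pi_i,0,0,\dots)$;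 the terminal object is $((1,+,0),1)$. The comultiplication $\delta:\mathrm{Faà}(\mathbb X)\to\mathrm{Faà}(\mathrm{Faà}(\mathbb X))$ is given on objects by $\delta(P)=(L(P),P)$, where for $P=((A,+,0),X)$ $$L(P)=\big(((A,+,0),A),\,(+,\pi_0+,0,0,\dots),\,(0,\pi_0 0,0,0,\dots)\big),\qquad L_0(P)=((A,+,0),A).$$ On maps, $\delta(f)_*=f$, and $[\delta(f)]_n:L_0(P)^n\times P\to L_0(Q)$ has the components $([\delta(f)]_n)_*=f_n$ and, for $m\ge1$, $$([\delta(f)]_n)_m\big(v_1,\dots,v_m,(a_1,\dots,a_n,x)\big)=\sum_{S} f_{m+n-|S|}\big((c_{ij})_{(i,j)\in S},\,(b_i)_{i\text{ unmatched}},\,(a_j)_{j\text{ unmatched}},\,x\big),$$ where $v_i=(c_{i1},\dots,c_{in},b_i)$ and $S$ runs over all partial matchings between $\{1,\dots,m\}$ and $\{1,\dots,n\}$. **Corollary.** For every Cartesian category $\mathbb X$, the category $\mathrm{Faà}(\mathbb X)$, with $L(P)$ as above and $$D[f]=[\delta(f)]_1,$$ is a generalized Cartesian differential category. Its differential structure is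 trivial (every $L_0(P)$ is terminal and every $D[f]$ is the map $!=0$) if and only if the carrier of every commutative monoid in $\mathbb X$ is a terminal object. If some commutative monoid in $\mathbb X$ has a non-terminal carrier, then some $L_0(P)$ is not terminal and some $D[f]$ is not $0$. -/

import Mathlib

open CategoryTheory MonoidalCategory CartesianMonoidalCategory

universe v u

noncomputable section

namespace FaaDiBruno

open scoped MonObj

section Tuples

variable {C : Type u} [Category.{v} C] [CartesianMonoidalCategory C]

/-- The object `A × (A × ⋯ × (A × X))` with `n` factors `A`, that is `Aⁿ × X`. -/
def vec (A X : C) : ℕ → C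
  | 0 => X
  | n + 1 => A ⊗ vec A X n

/-- The map `⟨a₀, …, aₙ₋₁, x⟩ : Γ ⟶ Aⁿ × X`. -/
def vlift {Γ A X : C} : (n : ℕ) → (Fin n → (Γ ⟶ A)) → (Γ ⟶ X) → (Γ ⟶ vec A X n)
  | 0, _, x => x
  | n + 1, a, x => lift (a 0) (vlift n (fun i => a i.succ) x)

/-- The projection of `Aⁿ × X` to the last factor `X`. -/
def vbase (A X : C) : (n : ℕ) → (vec A X n ⟶ X)
  | 0 => 𝟙 X
  | n + 1 => snd A (vec A X n) ≫ vbase A X n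

/-- The projection of `Aⁿ × X` to the `i`-th factor `A`. -/
def vproj (A X : C) : (n : ℕ) → Fin n → (vec A X n ⟶ A)
  | 0, i => i.elim0
  | n + 1, i => Fin.cases (fst A (vec A X n)) (fun j => snd A (vec A X n) ≫ vproj A X n j) i

theorem vlift_vbase {Γ A X : C} (n : ℕ) (a : Fin n → (Γ ⟶ A)) (x : Γ ⟶ X) :
    vlift n a x ≫ vbase A X n = x := by
  induction n with
  | zero => exact Category.comp_id _
  | succ n ih => exact (lift_snd_assoc _ _ _).trans (ih _)

theorem vlift_vproj {Γ A X : C} (n : ℕ) (a : Fin n → (Γ ⟶ A)) (x : Γ ⟶ X) (i : Fin n) :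
    vlift n a x ≫ vproj A X n i = a i := by
  induction n with
  | zero => exact i.elim0
  | succ n ih =>
    refine Fin.cases ?_ (fun j => ?_) i
    · exact lift_fst _ _
    · exact (lift_snd_assoc _ _ _).trans (ih _ _)

theorem comp_vlift {Δ Γ A X : C} (h : Δ ⟶ Γ) (n : ℕ) (a : Fin n → (Γ ⟶ A)) (x : Γ ⟶ X) :
    h ≫ vlift n a x = vlift n (fun i => h ≫ a i) (h ≫ x) := by
  induction n with
  | zero => rfl
  | succ n ih => exact (CartesianMonoidalCategory.comp_lift _ _ _).trans (congrArg _ (ih _))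

theorem vlift_self (A X : C) (n : ℕ) :
    vlift n (vproj A X n) (vbase A X n) = 𝟙 (vec A X n) := by
  induction n with
  | zero => rfl
  | succ n ih =>
    have h := comp_vlift (snd A (vec A X n)) n (vproj A X n) (vbase A X n)
    rw [ih, Category.comp_id] at h
    have : vlift (n + 1) (vproj A X (n + 1)) (vbase A X (n + 1)) =
      lift (fst A (vec A X n)) (snd A (vec A X n)) := by
      conv_rhs => rw [h]
      rfl
    rw [this]
    exact lift_fst_snd

theorem vec_hom_ext {Γ A X : C} {n : ℕ} {f g : Γ ⟶ vec A X n}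
    (h : ∀ i, f ≫ vproj A X n i = g ≫ vproj A X n i)
    (h' : f ≫ vbase A X n = g ≫ vbase A X n) : f = g := by
  rw [← Category.comp_id f, ← Category.comp_id g, ← vlift_self, comp_vlift, comp_vlift, h']
  simp only [h]

end Tuples

section Monoids

variable (C : Type u) [Category.{v} C] [CartesianMonoidalCategory C] [BraidedCategory C]

/-- A commutative monoid `(X, +, 0)` in `C`. -/
structure CMon where
  /-- The underlying object. -/
  X : C
  [add : AddMonObj X]
  [comm : IsCommAddMonObj X]

attribute [instance] CMon.add CMon.comm

variable {C}

/-- The commutative monoid structure on the terminal object. -/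
abbrev CMon.unit : CMon C := ⟨𝟙_ C⟩

/-- The product of two commutative monoids, with componentwise addition. -/
abbrev CMon.prod (A B : CMon C) : CMon C := ⟨A.X ⊗ B.X⟩

theorem comp_add {Δ Γ : C} {A : C} [AddMonObj A] [IsCommAddMonObj A] (h : Δ ⟶ Γ) (a b : Γ ⟶ A) :
    h ≫ (a + b) = h ≫ a + h ≫ b := AddMonObj.comp_add h a b

theorem comp_zero {Δ Γ : C} {A : C} [AddMonObj A] [IsCommAddMonObj A] (h : Δ ⟶ Γ) :
    h ≫ (0 : Γ ⟶ A) = 0 := AddMonObj.comp_zero h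

theorem comp_sum {Δ Γ : C} {A : C} [AddMonObj A] [IsCommAddMonObj A] {I : Type*} (h : Δ ⟶ Γ)
    (s : Finset I) (a : I → (Γ ⟶ A)) : h ≫ (∑ i ∈ s, a i) = ∑ i ∈ s, h ≫ a i :=
  map_sum (⟨⟨fun a => h ≫ a, comp_zero h⟩, fun a b => comp_add h a b⟩ : (Γ ⟶ A) →+ (Δ ⟶ A)) a s

/-- The category `Faà(C)` has as objects the pairs `((A, +, 0), X)` of a commutative monoid
`(A, +, 0)` in `C` and an object `X` of `C`. -/
structure Faa (C : Type u) [Category.{v} C] [CartesianMonoidalCategory C] [BraidedCategory C] where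
  /-- The commutative monoid `(A, +, 0)`. -/
  V : CMon C
  /-- The object `X`. -/
  pt : C

namespace Faa

/-- A morphism `((A, +, 0), X) ⟶ ((B, +, 0), Y)` of `Faà(C)` is a sequence `(f_*, f₁, f₂, …)`,
where `f_* : X ⟶ Y`, and each `fₙ : Aⁿ × X ⟶ B` (`n ≥ 1`) is symmetric and additive in its first
`n` variables. Symmetry and additivity are expressed with generalized elements. -/
@[ext]
structure Hom (P Q : Faa C) where
  /-- The component `f_*`. -/
  base : P.pt ⟶ Q.pt
  /-- The component `fₙ`, for `n ≥ 1`. -/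
  part : ∀ n : ℕ, 0 < n → (vec P.V.X P.pt n ⟶ Q.V.X)
  part_symm : ∀ (n : ℕ) (hn : 0 < n) (Γ : C) (a : Fin n → (Γ ⟶ P.V.X)) (x : Γ ⟶ P.pt)
    (τ : Equiv.Perm (Fin n)),
    vlift n (fun i => a (τ i)) x ≫ part n hn = vlift n a x ≫ part n hn
  part_add : ∀ (n : ℕ) (hn : 0 < n) (Γ : C) (a : Fin n → (Γ ⟶ P.V.X)) (x : Γ ⟶ P.pt) (i : Fin n)
    (b c : Γ ⟶ P.V.X),
    vlift n (Function.update a i (b + c)) x ≫ part n hn =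
      vlift n (Function.update a i b) x ≫ part n hn + vlift n (Function.update a i c) x ≫ part n hn
  part_zero : ∀ (n : ℕ) (hn : 0 < n) (Γ : C) (a : Fin n → (Γ ⟶ P.V.X)) (x : Γ ⟶ P.pt) (i : Fin n),
    vlift n (Function.update a i 0) x ≫ part n hn = 0

namespace Hom

variable {P Q R : Faa C}

/-- For a nonempty finite set `s` with `n` elements, `f.eval s a x` is `fₙ(a_i : i ∈ s; x)`; as
`fₙ` is symmetric, the order in which the elements of `s` are listed does not matter. -/
def eval (f : Hom P Q) {Γ : C} {I : Type} (s : Finset I) (a : I → (Γ ⟶ P.V.X)) (x : Γ ⟶ P.pt) :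
    Γ ⟶ Q.V.X :=
  if h : s.Nonempty then
    vlift s.card (fun i => a (s.equivFin.symm i)) x ≫ f.part s.card h.card_pos
  else 0

theorem eval_empty (f : Hom P Q) {Γ : C} {I : Type} (a : I → (Γ ⟶ P.V.X)) (x : Γ ⟶ P.pt) :
    f.eval ∅ a x = 0 := by simp [eval]

/-- `eval` may be computed with any enumeration of `s`. -/
theorem eval_eq (f : Hom P Q) {Γ : C} {I : Type} (s : Finset I) (a : I → (Γ ⟶ P.V.X))
    (x : Γ ⟶ P.pt) (n : ℕ) (hn : 0 < n) (e : Fin n ≃ s) :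
    f.eval s a x = vlift n (fun i => a (e i)) x ≫ f.part n hn := by
  have hc : n = s.card := by simpa using Fintype.card_congr e
  subst hc
  rw [eval, dif_pos (Finset.card_pos.1 hn)]
  rw [← f.part_symm _ hn Γ (fun i => a (e i)) x (s.equivFin.symm.trans e.symm)]
  simp

theorem comp_eval (f : Hom P Q) {Δ Γ : C} (h : Δ ⟶ Γ) {I : Type} (s : Finset I)
    (a : I → (Γ ⟶ P.V.X)) (x : Γ ⟶ P.pt) :
    h ≫ f.eval s a x = f.eval s (fun i => h ≫ a i) (h ≫ x) := by
  unfold eval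
  split_ifs
  · rw [← Category.assoc, comp_vlift]
  · exact comp_zero h

theorem eval_univ (f : Hom P Q) {Γ : C} (n : ℕ) (hn : 0 < n) (a : Fin n → (Γ ⟶ P.V.X))
    (x : Γ ⟶ P.pt) : f.eval Finset.univ a x = vlift n a x ≫ f.part n hn :=
  f.eval_eq _ a x n hn (Equiv.subtypeUnivEquiv (by simp)).symm

theorem part_eq_eval (f : Hom P Q) (n : ℕ) (hn : 0 < n) :
    f.part n hn = f.eval Finset.univ (vproj _ _ n) (vbase _ _ n) := by
  rw [eval_univ f n hn, vlift_self, Category.id_comp]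

theorem eval_congr (f : Hom P Q) {Γ : C} {I : Type} {s : Finset I} {a b : I → (Γ ⟶ P.V.X)}
    (x : Γ ⟶ P.pt) (h : ∀ i ∈ s, a i = b i) : f.eval s a x = f.eval s b x := by
  unfold eval
  split_ifs
  · congr 2
    ext i
    exact h _ (s.equivFin.symm i).2
  · rfl

theorem eval_image (f : Hom P Q) {Γ : C} {I K : Type} [DecidableEq K] {s : Finset I} (e : I → K)
    (he : Set.InjOn e s) (a : K → (Γ ⟶ P.V.X)) (x : Γ ⟶ P.pt) :
    f.eval (s.image e) a x = f.eval s (fun i => a (e i)) x := by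
  rcases s.eq_empty_or_nonempty with rfl | hs
  · simp [eval_empty]
  · let E : s ≃ (s.image e : Finset K) := Equiv.ofBijective
      (fun i => ⟨e i, Finset.mem_image_of_mem e i.2⟩)
      ⟨fun i j h => Subtype.ext (he i.2 j.2 (congrArg Subtype.val h)), fun ⟨k, hk⟩ => by
        obtain ⟨i, hi, rfl⟩ := Finset.mem_image.1 hk
        exact ⟨⟨i, hi⟩, rfl⟩⟩
    rw [f.eval_eq s _ x _ hs.card_pos s.equivFin.symm,
      f.eval_eq (s.image e) _ x _ hs.card_pos (s.equivFin.symm.trans E)]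
    rfl

theorem eval_map (f : Hom P Q) {Γ : C} {I K : Type} (s : Finset I) (e : I ↪ K)
    (a : K → (Γ ⟶ P.V.X)) (x : Γ ⟶ P.pt) :
    f.eval (s.map e) a x = f.eval s (fun i => a (e i)) x := by
  classical
  rw [Finset.map_eq_image]
  exact f.eval_image e e.injective.injOn a x

theorem eval_singleton (f : Hom P Q) {Γ : C} {I : Type} (i : I) (a : I → (Γ ⟶ P.V.X))
    (x : Γ ⟶ P.pt) : f.eval {i} a x = lift (a i) x ≫ f.part 1 one_pos := by
  rw [f.eval_eq {i} a x 1 one_pos (Equiv.ofUnique _ _)]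
  rfl

/-- Additivity of `eval` in the variable `i`. -/
theorem eval_add (f : Hom P Q) {Γ : C} {I : Type} {s : Finset I} {i : I} (hi : i ∈ s)
    {a b c : I → (Γ ⟶ P.V.X)} (x : Γ ⟶ P.pt) (h : a i = b i + c i)
    (hb : ∀ j ∈ s, j ≠ i → b j = a j) (hc : ∀ j ∈ s, j ≠ i → c j = a j) :
    f.eval s a x = f.eval s b x + f.eval s c x := by
  have hs : s.Nonempty := ⟨i, hi⟩
  simp only [f.eval_eq s _ x _ hs.card_pos s.equivFin.symm]
  have hk : ∀ j, j ≠ s.equivFin ⟨i, hi⟩ → ((s.equivFin.symm j : s) : I) ≠ i := by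
    rintro j hj rfl
    simp at hj
  have key : ∀ d : I → (Γ ⟶ P.V.X), (∀ j ∈ s, j ≠ i → d j = a j) →
      (fun j => d (s.equivFin.symm j : s)) =
        Function.update (fun j => a (s.equivFin.symm j : s)) (s.equivFin ⟨i, hi⟩) (d i) := by
    intro d hd
    ext j
    by_cases hj : j = s.equivFin ⟨i, hi⟩
    · subst hj; simp
    · rw [Function.update_of_ne hj]
      exact hd _ (s.equivFin.symm j).2 (hk j hj)
  rw [key a (fun _ _ _ => rfl), key b hb, key c hc, h, f.part_add]

theorem eval_eq_zero (f : Hom P Q) {Γ : C} {I : Type} {s : Finset I} {i : I} (hi : i ∈ s)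
    {a : I → (Γ ⟶ P.V.X)} (x : Γ ⟶ P.pt) (h : a i = 0) : f.eval s a x = 0 := by
  have hs : s.Nonempty := ⟨i, hi⟩
  rw [f.eval_eq s _ x _ hs.card_pos s.equivFin.symm]
  rw [← f.part_zero _ hs.card_pos Γ (fun j => a (s.equivFin.symm j : s)) x (s.equivFin ⟨i, hi⟩)]
  congr 2
  rw [Function.eq_update_iff]
  simp [h]

theorem ext_eval {f g : Hom P Q} (h : f.base = g.base)
    (h' : ∀ (Γ : C) (n : ℕ) (_ : 0 < n) (a : Fin n → (Γ ⟶ P.V.X)) (x : Γ ⟶ P.pt),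
      f.eval Finset.univ a x = g.eval Finset.univ a x) : f = g := by
  apply Hom.ext h
  funext n hn
  rw [part_eq_eval, part_eq_eval, h' _ n hn]

/-- A morphism of `Faà(C)` from a family of operations on finite families of generalized elements,
natural in the stage of definition, invariant under reindexing, and additive in each variable. -/
def ofFamily (base : P.pt ⟶ Q.pt)
    (F : ∀ {Γ : C} {I : Type} [DecidableEq I], Finset I → (I → (Γ ⟶ P.V.X)) → (Γ ⟶ P.pt) →
      (Γ ⟶ Q.V.X))
    (nat : ∀ {Δ Γ : C} {I : Type} [DecidableEq I] (h : Δ ⟶ Γ) (s : Finset I)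
      (a : I → (Γ ⟶ P.V.X)) (x : Γ ⟶ P.pt), h ≫ F s a x = F s (fun i => h ≫ a i) (h ≫ x))
    (reindex : ∀ {Γ : C} {I K : Type} [DecidableEq I] [DecidableEq K] (s : Finset I) (e : I ↪ K)
      (a : K → (Γ ⟶ P.V.X)) (x : Γ ⟶ P.pt), F (s.map e) a x = F s (fun i => a (e i)) x)
    (add : ∀ {Γ : C} {I : Type} [DecidableEq I] (s : Finset I) (i : I) (_ : i ∈ s)
      (a b c : I → (Γ ⟶ P.V.X)) (x : Γ ⟶ P.pt), a i = b i + c i → (∀ j, j ≠ i → b j = a j) →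
      (∀ j, j ≠ i → c j = a j) → F s a x = F s b x + F s c x)
    (zero : ∀ {Γ : C} {I : Type} [DecidableEq I] (s : Finset I) (i : I) (_ : i ∈ s)
      (a : I → (Γ ⟶ P.V.X)) (x : Γ ⟶ P.pt), a i = 0 → F s a x = 0) : Hom P Q where
  base := base
  part n _ := F Finset.univ (vproj P.V.X P.pt n) (vbase P.V.X P.pt n)
  part_symm n hn Γ a x τ := by
    simp only [nat, vlift_vbase, vlift_vproj]
    conv_rhs => rw [← Finset.map_univ_equiv τ]
    exact (reindex Finset.univ τ.toEmbedding a x).symm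
  part_add n hn Γ a x i b c := by
    simp only [nat, vlift_vbase, vlift_vproj]
    exact add _ i (Finset.mem_univ i) _ _ _ _ (by simp) (fun j hj => by simp [hj])
      (fun j hj => by simp [hj])
  part_zero n hn Γ a x i := by
    simp only [nat, vlift_vbase, vlift_vproj]
    exact zero _ i (Finset.mem_univ i) _ _ (by simp)

theorem ofFamily_eval (base : P.pt ⟶ Q.pt)
    (F : ∀ {Γ : C} {I : Type} [DecidableEq I], Finset I → (I → (Γ ⟶ P.V.X)) → (Γ ⟶ P.pt) →
      (Γ ⟶ Q.V.X))
    (nat reindex add zero) {Γ : C} {I : Type} [DecidableEq I] (s : Finset I) (hs : s.Nonempty)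
    (a : I → (Γ ⟶ P.V.X)) (x : Γ ⟶ P.pt) :
    (ofFamily base F nat reindex add zero).eval s a x = F s a x := by
  rw [eval_eq _ s a x _ hs.card_pos s.equivFin.symm]
  change _ ≫ F _ _ _ = _
  simp only [nat, vlift_vbase, vlift_vproj]
  let e : Fin s.card ↪ I := s.equivFin.symm.toEmbedding.trans (Function.Embedding.subtype _)
  have hm : Finset.univ.map e = s := by
    ext i
    simp only [Finset.mem_map, Finset.mem_univ, true_and]
    constructor
    · rintro ⟨j, rfl⟩
      exact (s.equivFin.symm j).2
    · intro hi
      exact ⟨s.equivFin ⟨i, hi⟩, by simp [e]⟩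
  conv_rhs => rw [← hm]
  exact (reindex Finset.univ e a x).symm


end Hom
end Faa
end Monoids

section Partitions

/-- The image of a set partition under an injective map. -/
def mapPart {I K : Type} [DecidableEq I] [DecidableEq K] (e : I ↪ K) {s : Finset I}
    (π : Finpartition s) : Finpartition (s.map e) :=
  Finpartition.ofExistsUnique (π.parts.map (Finset.mapEmbedding e).toEmbedding)
    (by
      intro p hp
      obtain ⟨q, hq, rfl⟩ := Finset.mem_map.1 hp
      exact Finset.map_subset_map.2 (π.le hq))
    (by
      intro k hk
      obtain ⟨i, hi, rfl⟩ := Finset.mem_map.1 hk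
      obtain ⟨t, ⟨ht, hit⟩, hu⟩ := π.existsUnique_mem hi
      refine ⟨t.map e, ⟨Finset.mem_map.2 ⟨t, ht, rfl⟩, Finset.mem_map_of_mem e hit⟩, ?_⟩
      rintro y ⟨hy, hiy⟩
      obtain ⟨q, hq, rfl⟩ := Finset.mem_map.1 hy
      have : i ∈ q := by
        obtain ⟨j, hj, hji⟩ := Finset.mem_map.1 hiy
        rwa [← e.injective hji]
      exact congrArg (Finset.map e) (hu q ⟨hq, this⟩))
    (by
      intro h
      obtain ⟨q, hq, hqe⟩ := Finset.mem_map.1 h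
      have : q = ∅ := Finset.map_eq_empty.1 hqe
      exact π.ne_bot hq this)

theorem mapPart_parts {I K : Type} [DecidableEq I] [DecidableEq K] (e : I ↪ K) {s : Finset I}
    (π : Finpartition s) :
    (mapPart e π).parts = π.parts.map (Finset.mapEmbedding e).toEmbedding := rfl

theorem mapPart_bijective {I K : Type} [DecidableEq I] [DecidableEq K] (e : I ↪ K)
    (s : Finset I) : Function.Bijective (mapPart e : Finpartition s → _) := by
  constructor
  · intro π π' h
    apply Finpartition.ext
    have := congrArg Finpartition.parts h
    rw [mapPart_parts, mapPart_parts] at this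
    exact Finset.map_injective _ this
  · intro ρ
    have hsub : ∀ p ∈ ρ.parts, ∃ q, q ⊆ s ∧ p = q.map e := fun p hp =>
      Finset.subset_map_iff.1 (ρ.le hp)
    have hsub' : ρ.parts ⊆ s.powerset.map (Finset.mapEmbedding e).toEmbedding := by
      intro p hp
      obtain ⟨q, hq, rfl⟩ := hsub p hp
      exact Finset.mem_map.2 ⟨q, Finset.mem_powerset.2 hq, rfl⟩
    obtain ⟨T, hT, hTe⟩ := Finset.subset_map_iff.1 hsub'
    have hmem : ∀ q, q ∈ T ↔ q.map e ∈ ρ.parts := by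
      intro q
      rw [hTe]
      exact (Finset.mem_map' (Finset.mapEmbedding e).toEmbedding).symm
    refine ⟨Finpartition.ofExistsUnique T (fun p hp => Finset.mem_powerset.1 (hT hp)) ?_ ?_, ?_⟩
    · intro i hi
      obtain ⟨t, ⟨ht, hit⟩, hu⟩ := ρ.existsUnique_mem (Finset.mem_map_of_mem e hi)
      obtain ⟨q, hq, rfl⟩ := hsub t ht
      refine ⟨q, ⟨(hmem q).2 ht, (Finset.mem_map' e).1 hit⟩, ?_⟩
      rintro y ⟨hy, hiy⟩
      exact Finset.map_injective e (hu _ ⟨(hmem y).1 hy, (Finset.mem_map' e).2 hiy⟩)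
    · intro h
      have := (hmem ∅).1 h
      exact ρ.ne_bot this rfl
    · apply Finpartition.ext
      exact hTe.symm

/-- A set partition of `s` with set partitions of all its blocks gives a set partition of `s` into
the smaller blocks, with a set partition of its set of blocks. -/
def assocMap {I : Type} [DecidableEq I] {s : Finset I}
    (x : (σ : Finpartition s) × (∀ R : σ.parts, Finpartition R.1)) :
    (π : Finpartition s) × Finpartition π.parts :=
  ⟨x.1.bind (fun R hR => x.2 ⟨R, hR⟩),
    Finpartition.ofExistsUnique (Finset.univ.image fun R => (x.2 R).parts)
    (by
      obtain ⟨σ, φ⟩ := x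
      intro p hp B hB
      obtain ⟨R, -, rfl⟩ := Finset.mem_image.1 hp
      exact Finpartition.mem_bind.2 ⟨R.1, R.2, hB⟩)
    (by
      obtain ⟨σ, φ⟩ := x
      intro B hB
      obtain ⟨R, hR, hB⟩ := Finpartition.mem_bind.1 hB
      refine ⟨(φ ⟨R, hR⟩).parts, ⟨Finset.mem_image_of_mem _ (Finset.mem_univ _), hB⟩, ?_⟩
      rintro y ⟨hy, hBy⟩
      obtain ⟨R', -, rfl⟩ := Finset.mem_image.1 hy
      obtain ⟨i, hi⟩ := Finset.nonempty_iff_ne_empty.2 ((φ ⟨R, hR⟩).ne_bot hB)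
      have : R' = ⟨R, hR⟩ := Subtype.ext
        (σ.eq_of_mem_parts R'.2 hR ((φ R').le hBy hi) ((φ ⟨R, hR⟩).le hB hi))
      rw [this])
    (by
      obtain ⟨σ, φ⟩ := x
      intro h
      obtain ⟨R, -, hR⟩ := Finset.mem_image.1 h
      exact σ.ne_bot R.2 ((φ R).parts_eq_empty_iff.1 hR))⟩

theorem assocMap_bijective {I : Type} [DecidableEq I] (s : Finset I) :
    Function.Bijective (assocMap (s := s)) := by
  constructor
  · rintro ⟨σ, φ⟩ ⟨σ', φ'⟩ h
    have hparts : (Finset.univ.image fun R => (φ R).parts) =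
        (Finset.univ.image fun R => (φ' R).parts) := by
      have := congrArg (fun z : (π : Finpartition s) × Finpartition π.parts => z.2.parts) h
      exact this
    have hσ : σ = σ' := by
      have key : ∀ (τ : Finpartition s) (ψ : ∀ R : τ.parts, Finpartition R.1),
          τ.parts = (Finset.univ.image fun R => (ψ R).parts).image (fun p => p.sup id) := by
        intro τ ψ
        ext R
        simp only [Finset.image_image, Finset.mem_image, Finset.mem_univ, true_and,
          Function.comp]
        constructor
        · intro hR
          exact ⟨⟨R, hR⟩, (ψ ⟨R, hR⟩).sup_parts⟩
        · rintro ⟨R', rfl⟩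
          rw [(ψ R').sup_parts]
          exact R'.2
      apply Finpartition.ext
      rw [key σ φ, key σ' φ', hparts]
    subst hσ
    congr 1
    funext R
    apply Finpartition.ext
    have : (φ R).parts ∈ (Finset.univ.image fun R => (φ' R).parts) :=
      hparts ▸ Finset.mem_image_of_mem _ (Finset.mem_univ R)
    obtain ⟨R', -, hR'⟩ := Finset.mem_image.1 this
    have h2 : R' = R := by
      apply Subtype.ext
      rw [← (φ R).sup_parts, ← hR', (φ' R').sup_parts]
    rw [← hR', h2]
  · rintro ⟨π, ρ⟩
    have hinj : ∀ p ∈ ρ.parts, ∀ q ∈ ρ.parts, ∀ i, i ∈ p.sup id → i ∈ q.sup id → p = q := by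
      intro p hp q hq i hip hiq
      obtain ⟨B, hB, hiB⟩ := Finset.mem_sup.1 hip
      obtain ⟨B', hB', hiB'⟩ := Finset.mem_sup.1 hiq
      have : B = B' := π.eq_of_mem_parts (ρ.le hp hB) (ρ.le hq hB') hiB hiB'
      subst this
      exact ρ.eq_of_mem_parts hp hq hB hB'
    let σ : Finpartition s := Finpartition.ofExistsUnique (ρ.parts.image fun p => p.sup id)
      (by
        intro R hR i hi
        obtain ⟨p, hp, rfl⟩ := Finset.mem_image.1 hR
        obtain ⟨B, hB, hiB⟩ := Finset.mem_sup.1 hi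
        exact π.le (ρ.le hp hB) hiB)
      (by
        intro i hi
        obtain ⟨B, hB, hiB⟩ := π.exists_mem hi
        obtain ⟨p, hp, hBp⟩ := ρ.exists_mem hB
        have hip : i ∈ p.sup id := Finset.mem_sup.2 ⟨B, hBp, hiB⟩
        refine ⟨p.sup id, ⟨Finset.mem_image_of_mem _ hp, hip⟩, ?_⟩
        rintro y ⟨hy, hiy⟩
        obtain ⟨q, hq, rfl⟩ := Finset.mem_image.1 hy
        rw [hinj q hq p hp i hiy hip])
      (by
        intro h
        obtain ⟨p, hp, hpe⟩ := Finset.mem_image.1 h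
        obtain ⟨B, hB⟩ := Finset.nonempty_iff_ne_empty.2 (ρ.ne_bot hp)
        obtain ⟨i, hi⟩ := Finset.nonempty_iff_ne_empty.2 (π.ne_bot (ρ.le hp hB))
        have : i ∈ p.sup id := Finset.mem_sup.2 ⟨B, hB, hi⟩
        rw [hpe] at this
        simp at this)
    have hex : ∀ R : σ.parts, ∃ p ∈ ρ.parts, p.sup id = R.1 := fun R =>
      Finset.mem_image.1 R.2
    choose p hp hpR using hex
    let φ : ∀ R : σ.parts, Finpartition R.1 := fun R =>
      { parts := p R
        supIndep := π.supIndep.subset (ρ.le (hp R))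
        sup_parts := hpR R
        bot_notMem := fun h => π.bot_notMem (ρ.le (hp R) h) }
    have himg : (Finset.univ.image fun R => (φ R).parts) = ρ.parts := by
      ext q
      simp only [Finset.mem_image, Finset.mem_univ, true_and]
      constructor
      · rintro ⟨R, rfl⟩
        exact hp R
      · intro hq
        have hR : q.sup id ∈ σ.parts := Finset.mem_image_of_mem _ hq
        refine ⟨⟨q.sup id, hR⟩, ?_⟩
        obtain ⟨B, hB⟩ := Finset.nonempty_iff_ne_empty.2 (ρ.ne_bot hq)
        obtain ⟨i, hi⟩ := Finset.nonempty_iff_ne_empty.2 (π.ne_bot (ρ.le hq hB))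
        have hiq : i ∈ q.sup id := Finset.mem_sup.2 ⟨B, hB, hi⟩
        exact hinj _ (hp _) q hq i (by rw [hpR]; exact hiq) hiq
    refine ⟨⟨σ, φ⟩, ?_⟩
    have hπ : σ.bind (fun R hR => φ ⟨R, hR⟩) = π := by
      apply Finpartition.ext
      ext B
      rw [Finpartition.mem_bind]
      constructor
      · rintro ⟨R, hR, hB⟩
        exact ρ.le (hp ⟨R, hR⟩) hB
      · intro hB
        obtain ⟨q, hq, hBq⟩ := ρ.exists_mem hB
        rw [← himg] at hq
        obtain ⟨R, -, rfl⟩ := Finset.mem_image.1 hq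
        exact ⟨R.1, R.2, hBq⟩
    have aux : ∀ (π₁ : Finpartition s) (ρ₁ : Finpartition π₁.parts), π₁ = π →
        ρ₁.parts = ρ.parts →
        (⟨π₁, ρ₁⟩ : (π : Finpartition s) × Finpartition π.parts) = ⟨π, ρ⟩ := by
      rintro π₁ ρ₁ rfl h
      rw [Finpartition.ext h]
    exact aux _ _ hπ himg

theorem sum_partition_assoc {M : Type*} [AddCommMonoid M] {I : Type} [DecidableEq I] (s : Finset I)
    (G : Finset (Finset (Finset I)) → M) :
    ∑ σ : Finpartition s, ∑ φ : (∀ R : σ.parts, Finpartition R.1),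
      G (Finset.univ.image fun R => (φ R).parts) =
    ∑ π : Finpartition s, ∑ ρ : Finpartition π.parts, G ρ.parts := by
  rw [← Fintype.sum_sigma', ← Fintype.sum_sigma']
  exact Fintype.sum_bijective assocMap (assocMap_bijective s) _ _ (fun _ => rfl)

end Partitions

section Composition

variable {C : Type u} [Category.{v} C] [CartesianMonoidalCategory C] [BraidedCategory C]

namespace Faa
namespace Hom

variable {P Q R S : Faa C}

/-- `eval` as a multilinear map. -/
def multi (f : Hom P Q) {Γ : C} {J : Type} [Fintype J] [DecidableEq J] (x : Γ ⟶ P.pt) :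
    MultilinearMap ℕ (fun _ : J => (Γ ⟶ P.V.X)) (Γ ⟶ Q.V.X) :=
  have hadd : ∀ [DecidableEq J] (a : J → (Γ ⟶ P.V.X)) (i : J) (b c : Γ ⟶ P.V.X),
      f.eval Finset.univ (Function.update a i (b + c)) x =
        f.eval Finset.univ (Function.update a i b) x +
          f.eval Finset.univ (Function.update a i c) x := fun a i b c =>
    f.eval_add (Finset.mem_univ i) x (by simp) (fun j _ hj => by simp [hj])
      (fun j _ hj => by simp [hj])
  { toFun := fun a => f.eval Finset.univ a x
    map_update_add' := hadd
    map_update_smul' := fun a i n b => by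
      induction n with
      | zero =>
        rw [zero_smul, zero_smul]
        exact f.eval_eq_zero (Finset.mem_univ i) x (by simp)
      | succ n ih => rw [succ_nsmul, hadd, ih, succ_nsmul] }

theorem eval_sum (f : Hom P Q) {Γ : C} {I : Type} [DecidableEq I] (s : Finset I) {κ : I → Type}
    [∀ i, Fintype (κ i)] (b : ∀ i, κ i → (Γ ⟶ P.V.X)) (x : Γ ⟶ P.pt) :
    f.eval s (fun i => ∑ k, b i k) x =
      ∑ φ : (∀ i : s, κ i.1), f.eval (Finset.univ : Finset s) (fun i => b i.1 (φ i)) x := by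
  have h : s = (Finset.univ : Finset s).map (Function.Embedding.subtype _) := by
    ext i; simp
  have h1 : f.eval s (fun i => ∑ k, b i k) x =
      f.eval (Finset.univ : Finset s) (fun i => ∑ k, b i.1 k) x := by
    conv_lhs => rw [h]
    rw [eval_map]
    rfl
  rw [h1]
  exact (f.multi (J := s) x).map_sum (fun (i : s) (k : κ i.1) => b i.1 k)

/-- The sum `∑ g_k(f(a_i : i ∈ B₁; x), …, f(a_i : i ∈ B_k; x); f_*(x))` over all partitions
`{B₁, …, B_k}` of the finite set `s`. -/
def compFam (f : Hom P Q) (g : Hom Q R) {Γ : C} {I : Type} [DecidableEq I] (s : Finset I)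
    (a : I → (Γ ⟶ P.V.X)) (x : Γ ⟶ P.pt) : Γ ⟶ R.V.X :=
  ∑ π : Finpartition s, g.eval π.parts (fun B => f.eval B a x) (x ≫ f.base)

/-- The Faà di Bruno composite: `(fg)_* = f_* g_*` and
`(fg)ₙ(a₁, …, aₙ, x) = ∑ g_k(f(a_i : i ∈ B₁; x), …, f(a_i : i ∈ B_k; x); f_*(x))`,
where the sum is over all partitions `{B₁, …, B_k}` of `{1, …, n}`. -/
def comp (f : Hom P Q) (g : Hom Q R) : Hom P R :=
  ofFamily (f.base ≫ g.base) (compFam f g)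
    (by
      intro Δ Γ I _ h s a x
      simp only [compFam, comp_sum, comp_eval, Category.assoc])
    (by
      intro Γ I K _ _ s e a x
      refine (Fintype.sum_bijective (mapPart e) (mapPart_bijective e s) _ _ fun π => ?_).symm
      rw [mapPart_parts, eval_map]
      refine eval_congr g _ fun B _ => ?_
      exact (eval_map f B e a x).symm)
    (by
      intro Γ I _ s i hi a b c x h hb hc
      simp only [compFam]
      rw [← Finset.sum_add_distrib]
      refine Finset.sum_congr rfl fun π _ => ?_
      obtain ⟨B, hB, hiB⟩ := π.exists_mem hi
      have hne : ∀ B' ∈ π.parts, B' ≠ B → ∀ j ∈ B', j ≠ i := by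
        rintro B' hB' hBB j hj rfl
        exact hBB (π.eq_of_mem_parts hB' hB hj hiB)
      refine g.eval_add hB _ (f.eval_add hiB x h (fun j _ hj => hb j hj) (fun j _ hj => hc j hj))
        (fun B' hB' hBB => f.eval_congr x fun j hj => hb j (hne B' hB' hBB j hj))
        (fun B' hB' hBB => f.eval_congr x fun j hj => hc j (hne B' hB' hBB j hj)))
    (by
      intro Γ I _ s i hi a x h
      refine Finset.sum_eq_zero fun π _ => ?_
      obtain ⟨B, hB, hiB⟩ := π.exists_mem hi
      exact g.eval_eq_zero hB _ (f.eval_eq_zero hiB x h))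

theorem comp_base (f : Hom P Q) (g : Hom Q R) : (f.comp g).base = f.base ≫ g.base := rfl

theorem compFam_empty (f : Hom P Q) (g : Hom Q R) {Γ : C} {I : Type} [DecidableEq I]
    (a : I → (Γ ⟶ P.V.X)) (x : Γ ⟶ P.pt) : compFam f g ∅ a x = 0 := by
  refine Finset.sum_eq_zero fun π _ => ?_
  have : π.parts = ∅ := π.parts_eq_empty_iff.2 rfl
  rw [this, eval_empty]

theorem eval_comp (f : Hom P Q) (g : Hom Q R) {Γ : C} {I : Type} [DecidableEq I] (s : Finset I)
    (a : I → (Γ ⟶ P.V.X)) (x : Γ ⟶ P.pt) :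
    (f.comp g).eval s a x =
      ∑ π : Finpartition s, g.eval π.parts (fun B => f.eval B a x) (x ≫ f.base) := by
  rcases s.eq_empty_or_nonempty with rfl | hs
  · rw [eval_empty]
    exact (compFam_empty f g a x).symm
  · exact ofFamily_eval _ _ _ _ _ _ s hs a x

theorem comp_assoc (f : Hom P Q) (g : Hom Q R) (h : Hom R S) :
    (f.comp g).comp h = f.comp (g.comp h) := by
  refine ext_eval (Category.assoc _ _ _) fun Γ n hn a x => ?_
  simp only [eval_comp, comp_base]
  rw [← sum_partition_assoc Finset.univ (fun T => h.eval T (fun p =>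
    g.eval p (fun B => f.eval B a x) (x ≫ f.base)) ((x ≫ f.base) ≫ g.base))]
  refine Finset.sum_congr rfl fun σ _ => ?_
  rw [eval_sum (κ := fun R => Finpartition R) h σ.parts (fun R π => g.eval π.parts
    (fun B => f.eval B a x) (x ≫ f.base))]
  refine Finset.sum_congr rfl fun φ _ => ?_
  rw [eval_image, Category.assoc]
  intro R₁ _ R₂ _ hR
  apply Subtype.ext
  rw [← (φ R₁).sup_parts, ← (φ R₂).sup_parts]
  exact congrArg (fun p => Finset.sup p id) hR

/-- The morphism `(u, π₀ h, 0, 0, …)`, for an additive map `h`. -/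
def linear {P Q : Faa C} (u : P.pt ⟶ Q.pt) (h : P.V.X ⟶ Q.V.X) [IsAddMonHom h] : Hom P Q where
  base := u
  part n hn := if n = 1 then vproj P.V.X P.pt n ⟨0, hn⟩ ≫ h else 0
  part_symm n hn Γ a x τ := by
    split_ifs with h1
    · subst h1
      simp only [← Category.assoc, vlift_vproj]
      rw [Subsingleton.elim (τ ⟨0, hn⟩) ⟨0, hn⟩]
    · simp only [comp_zero]
  part_add n hn Γ a x i b c := by
    split_ifs with h1
    · subst h1
      rw [Subsingleton.elim i ⟨0, hn⟩]
      simp only [← Category.assoc, vlift_vproj, Function.update_self]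
      exact AddMonObj.add_comp b c h
    · simp only [comp_zero, add_zero]
  part_zero n hn Γ a x i := by
    split_ifs with h1
    · subst h1
      rw [Subsingleton.elim i ⟨0, hn⟩]
      simp only [← Category.assoc, vlift_vproj, Function.update_self]
      exact AddMonObj.zero_comp h
    · simp only [comp_zero]

theorem linear_eval_singleton (u : P.pt ⟶ Q.pt) (h : P.V.X ⟶ Q.V.X) [IsAddMonHom h] {Γ : C}
    {I : Type} (i : I) (a : I → (Γ ⟶ P.V.X)) (x : Γ ⟶ P.pt) :
    (linear u h).eval {i} a x = a i ≫ h := by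
  rw [eval_singleton]
  change lift (a i) x ≫ fst _ _ ≫ h = a i ≫ h
  rw [lift_fst_assoc]

theorem linear_eval_ne_one (u : P.pt ⟶ Q.pt) (h : P.V.X ⟶ Q.V.X) [IsAddMonHom h] {Γ : C}
    {I : Type} (s : Finset I) (hs : s.card ≠ 1) (a : I → (Γ ⟶ P.V.X)) (x : Γ ⟶ P.pt) :
    (linear u h).eval s a x = 0 := by
  unfold eval
  split_ifs with h0
  · change _ ≫ (if s.card = 1 then _ else _) = _
    rw [if_neg hs]
    exact comp_zero _
  · rfl

/-- Composition with a linear morphism on the right. -/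
theorem eval_comp_linear (f : Hom P Q) (u : Q.pt ⟶ R.pt) (h : Q.V.X ⟶ R.V.X) [IsAddMonHom h]
    {Γ : C} {I : Type} (s : Finset I) (a : I → (Γ ⟶ P.V.X)) (x : Γ ⟶ P.pt) :
    (f.comp (linear u h)).eval s a x = f.eval s a x ≫ h := by
  classical
  rcases s.eq_empty_or_nonempty with rfl | hs
  · rw [eval_empty, eval_empty]
    exact (AddMonObj.zero_comp h).symm
  · rw [eval_comp, Finset.sum_eq_single (Finpartition.indiscrete hs.ne_empty)]
    · exact linear_eval_singleton u h s _ _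
    · intro π _ hπ
      refine linear_eval_ne_one _ _ _ (fun hc => hπ ?_) _ _
      obtain ⟨B, hB⟩ := Finset.card_eq_one.1 hc
      apply Finpartition.ext
      have := π.sup_parts
      rw [hB, Finset.sup_singleton] at this
      rw [hB]
      change {B} = {s}
      rw [← this]
      rfl
    · intro h; exact absurd (Finset.mem_univ _) h

/-- Composition with a linear morphism on the left. -/
theorem eval_linear_comp (u : P.pt ⟶ Q.pt) (h : P.V.X ⟶ Q.V.X) [IsAddMonHom h] (g : Hom Q R)
    {Γ : C} {I : Type} (s : Finset I) (a : I → (Γ ⟶ P.V.X)) (x : Γ ⟶ P.pt) :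
    ((linear u h).comp g).eval s a x = g.eval s (fun i => a i ≫ h) (x ≫ u) := by
  classical
  rw [eval_comp, Finset.sum_eq_single ⊥]
  · rw [Finpartition.parts_bot, eval_map]
    refine eval_congr g _ fun i _ => ?_
    exact linear_eval_singleton u h i a x
  · intro π _ hπ
    have : ∃ B ∈ π.parts, B.card ≠ 1 := by
      by_contra! hall
      apply hπ
      have hle : π ≤ ⊥ := by
        intro B hB
        obtain ⟨i, hi⟩ := Finset.card_eq_one.1 (hall B hB)
        exact ⟨{i}, Finpartition.mem_bot_iff.2 ⟨i, π.le hB (by simp [hi]), rfl⟩, hi.le⟩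
      exact le_bot_iff.1 hle
    obtain ⟨B, hB, hB1⟩ := this
    exact g.eval_eq_zero hB _ (linear_eval_ne_one u h B hB1 a x)
  · intro h; exact absurd (Finset.mem_univ _) h

end Hom

open Hom

/-- `Faà(C)` is a category: the identities are `(1, π₀, 0, 0, …)`, and composition is given by the
Faà di Bruno formula. -/
instance : Category.{v} (Faa C) where
  Hom P Q := Hom P Q
  id P := linear (𝟙 P.pt) (𝟙 P.V.X)
  comp f g := f.comp g
  id_comp f := by
    refine ext_eval (Category.id_comp _) fun Γ n hn a x => ?_
    rw [eval_linear_comp]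
    simp only [Category.comp_id]
  comp_id f := by
    refine ext_eval (Category.comp_id _) fun Γ n hn a x => ?_
    rw [eval_comp_linear, Category.comp_id]
  assoc f g h := comp_assoc f g h

end Faa
end Composition

section Products

variable {C : Type u} [Category.{v} C] [CartesianMonoidalCategory C] [BraidedCategory C]

theorem lift_add_lift {Γ A B : C} [AddMonObj A] [IsCommAddMonObj A] [AddMonObj B]
    [IsCommAddMonObj B] (a a' : Γ ⟶ A) (b b' : Γ ⟶ B) :
    lift a b + lift a' b' = lift (a + a') (b + b') := by
  apply CartesianMonoidalCategory.hom_ext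
  · exact (AddMonObj.add_comp _ _ (fst A B)).trans (by simp only [lift_fst])
  · exact (AddMonObj.add_comp _ _ (snd A B)).trans (by simp only [lift_snd])

theorem lift_zero_zero {Γ A B : C} [AddMonObj A] [IsCommAddMonObj A] [AddMonObj B]
    [IsCommAddMonObj B] : lift (0 : Γ ⟶ A) (0 : Γ ⟶ B) = 0 := by
  apply CartesianMonoidalCategory.hom_ext
  · exact (lift_fst _ _).trans (AddMonObj.zero_comp (fst A B)).symm
  · exact (lift_snd _ _).trans (AddMonObj.zero_comp (snd A B)).symm

namespace Faa

/-- The product `((A × B, …), X × Y)` of `((A, …), X)` and `((B, …), Y)`. -/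
abbrev prod (P Q : Faa C) : Faa C := ⟨P.V.prod Q.V, P.pt ⊗ Q.pt⟩

/-- The terminal object `((1, …), 1)`. -/
abbrev unit : Faa C := ⟨CMon.unit, 𝟙_ C⟩

namespace Hom

variable {P Q R S : Faa C}

/-- The pairing `(⟨f_*, g_*⟩, ⟨f₁, g₁⟩, ⟨f₂, g₂⟩, …)`. -/
def pair (f : Hom R P) (g : Hom R Q) : Hom R (P.prod Q) where
  base := lift f.base g.base
  part n hn := lift (f.part n hn) (g.part n hn)
  part_symm n hn Γ a x τ := by
    simp only [comp_lift]
    rw [f.part_symm, g.part_symm]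
  part_add n hn Γ a x i b c := by
    simp only [comp_lift]
    rw [f.part_add, g.part_add]
    exact (lift_add_lift _ _ _ _).symm
  part_zero n hn Γ a x i := by
    simp only [comp_lift]
    rw [f.part_zero, g.part_zero]
    exact lift_zero_zero

theorem pair_eval (f : Hom R P) (g : Hom R Q) {Γ : C} {I : Type} (s : Finset I)
    (a : I → (Γ ⟶ R.V.X)) (x : Γ ⟶ R.pt) :
    (pair f g).eval s a x = lift (f.eval s a x) (g.eval s a x) := by
  unfold eval
  split_ifs
  · exact comp_lift _ _ _
  · exact lift_zero_zero.symm

/-- The projection `(π₀, π₀ π₀, 0, 0, …)`. -/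
abbrev proj₁ (P Q : Faa C) : Hom (P.prod Q) P := linear (fst P.pt Q.pt) (fst P.V.X Q.V.X)

/-- The projection `(π₁, π₀ π₁, 0, 0, …)`. -/
abbrev proj₂ (P Q : Faa C) : Hom (P.prod Q) Q := linear (snd P.pt Q.pt) (snd P.V.X Q.V.X)

/-- The morphism to the terminal object. -/
abbrev bang (P : Faa C) : Hom P unit := linear (toUnit P.pt) (toUnit P.V.X)

theorem pair_proj₁ (f : Hom R P) (g : Hom R Q) : (pair f g).comp (proj₁ P Q) = f :=
  ext_eval (lift_fst _ _) fun Γ n hn a x => by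
    rw [eval_comp_linear, pair_eval, lift_fst]

theorem pair_proj₂ (f : Hom R P) (g : Hom R Q) : (pair f g).comp (proj₂ P Q) = g :=
  ext_eval (lift_snd _ _) fun Γ n hn a x => by
    rw [eval_comp_linear, pair_eval, lift_snd]

theorem pair_uniq (m : Hom R (P.prod Q)) :
    m = pair (m.comp (proj₁ P Q)) (m.comp (proj₂ P Q)) := by
  refine ext_eval ?_ fun Γ n hn a x => ?_
  · exact (CartesianMonoidalCategory.hom_ext _ _ (lift_fst _ _) (lift_snd _ _)).symm
  · rw [pair_eval, eval_comp_linear, eval_comp_linear]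
    exact (CartesianMonoidalCategory.hom_ext _ _ (lift_fst _ _) (lift_snd _ _)).symm

end Hom

open Hom

/-- The binary products of `Faà(C)`. -/
def productCone (P Q : Faa C) : Limits.LimitCone (Limits.pair P Q) where
  cone := Limits.BinaryFan.mk (P := P.prod Q) (proj₁ P Q) (proj₂ P Q)
  isLimit := Limits.BinaryFan.IsLimit.mk _ (fun f g => pair f g)
    (fun f g => pair_proj₁ f g) (fun f g => pair_proj₂ f g)
    (fun {R} f g m h₁ h₂ => by subst h₁ h₂; exact pair_uniq m)

/-- The terminal object of `Faà(C)`. -/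
def terminalCone : Limits.LimitCone (Functor.empty.{0} (Faa C)) where
  cone := Limits.asEmptyCone unit
  isLimit := Limits.IsTerminal.ofUniqueHom (fun P => bang P) fun _ _ =>
    ext_eval (toUnit_unique _ _) fun _ _ _ _ _ => toUnit_unique _ _

/-- The specified finite products of `Faà(C)`. -/
instance : CartesianMonoidalCategory (Faa C) :=
  CartesianMonoidalCategory.ofChosenFiniteProducts terminalCone productCone

instance : BraidedCategory (Faa C) := BraidedCategory.ofCartesianMonoidalCategory

theorem tensorObj_eq (P Q : Faa C) : P ⊗ Q = P.prod Q := rfl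
theorem tensorUnit_eq : 𝟙_ (Faa C) = unit := rfl
theorem fst_eq (P Q : Faa C) : fst P Q = proj₁ P Q := rfl
theorem snd_eq (P Q : Faa C) : snd P Q = proj₂ P Q := rfl
theorem lift_eq {P Q R : Faa C} (f : R ⟶ P) (g : R ⟶ Q) : lift f g = pair f g := rfl

/-- The object `((A, +, 0), A)` of `Faà(C)`. -/
abbrev lamObj (A : CMon C) : Faa C := ⟨A, A.X⟩

/-- The morphism `(h, π₀ h, 0, 0, …)` of `Faà(C)`, for a map `h` of commutative monoids. -/
def lam {A B : CMon C} (h : A.X ⟶ B.X) [IsAddMonHom h] : lamObj A ⟶ lamObj B :=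
  Hom.linear (P := lamObj A) (Q := lamObj B) h h

end Faa

end Products

section Vectors

variable {C : Type u} [Category.{v} C] [CartesianMonoidalCategory C] [BraidedCategory C]

namespace Faa

open Hom

theorem lam_congr {A B : CMon C} {h k : A.X ⟶ B.X} [IsAddMonHom h] [IsAddMonHom k] (e : h = k) :
    lam h = lam k := by
  subst e; rfl

theorem lam_eval_singleton {A B : CMon C} (h : A.X ⟶ B.X) [IsAddMonHom h] {Γ : C} {I : Type}
    (i : I) (a : I → (Γ ⟶ A.X)) (x : Γ ⟶ A.X) : Hom.eval (lam h) {i} a x = a i ≫ h :=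
  linear_eval_singleton (P := lamObj A) (Q := lamObj B) h h i a x

theorem lam_eval_ne_one {A B : CMon C} (h : A.X ⟶ B.X) [IsAddMonHom h] {Γ : C} {I : Type}
    (s : Finset I) (hs : s.card ≠ 1) (a : I → (Γ ⟶ A.X)) (x : Γ ⟶ A.X) :
    Hom.eval (lam h) s a x = 0 :=
  linear_eval_ne_one (P := lamObj A) (Q := lamObj B) h h s hs a x

theorem eval_comp_lam {A B : CMon C} {P : Faa C} (f : P ⟶ lamObj A) (h : A.X ⟶ B.X)
    [IsAddMonHom h] {Γ : C} {I : Type} (s : Finset I) (a : I → (Γ ⟶ P.V.X)) (x : Γ ⟶ P.pt) :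
    Hom.eval (f ≫ lam h) s a x = Hom.eval f s a x ≫ h :=
  eval_comp_linear (Q := lamObj A) (R := lamObj B) f h h s a x

theorem lam_comp {A B D : CMon C} (h : A.X ⟶ B.X) (k : B.X ⟶ D.X) [IsAddMonHom h]
    [IsAddMonHom k] : lam h ≫ lam k = lam (A := A) (B := D) (h ≫ k) :=
  ext_eval rfl fun Γ n hn a x => by
    rw [eval_comp_lam]
    by_cases h1 : n = 1
    · subst h1
      have e : (Finset.univ : Finset (Fin 1)) = {0} := rfl
      rw [e, lam_eval_singleton, lam_eval_singleton, Category.assoc]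
    · have hc : (Finset.univ : Finset (Fin n)).card ≠ 1 := by simpa using h1
      rw [lam_eval_ne_one _ _ hc, lam_eval_ne_one _ _ hc]
      exact AddMonObj.zero_comp k

theorem fst_lam (A B : CMon C) :
    fst (lamObj A) (lamObj B) = lam (A := A.prod B) (B := A) (fst A.X B.X) := rfl

theorem snd_lam (A B : CMon C) :
    snd (lamObj A) (lamObj B) = lam (A := A.prod B) (B := B) (snd A.X B.X) := rfl

theorem whiskerRight_lam {A B D : CMon C} (h : A.X ⟶ B.X) [IsAddMonHom h] :
    lam h ▷ lamObj D = lam (A := A.prod D) (B := B.prod D) (h ▷ D.X) := by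
  apply CartesianMonoidalCategory.hom_ext
  · rw [whiskerRight_fst, fst_lam, fst_lam]
    refine (lam_comp (A := A.prod D) (B := A) (D := B) (fst A.X D.X) h).trans ?_
    refine (lam_congr ?_).trans
      (lam_comp (A := A.prod D) (B := B.prod D) (D := B) (h ▷ D.X) (fst B.X D.X)).symm
    exact (whiskerRight_fst _ _).symm
  · rw [whiskerRight_snd, snd_lam, snd_lam]
    refine (lam_congr ?_).trans
      (lam_comp (A := A.prod D) (B := B.prod D) (D := D) (h ▷ D.X) (snd B.X D.X)).symm
    exact (whiskerRight_snd _ _).symm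

theorem whiskerLeft_lam {A B D : CMon C} (h : A.X ⟶ B.X) [IsAddMonHom h] :
    lamObj D ◁ lam h = lam (A := D.prod A) (B := D.prod B) (D.X ◁ h) := by
  apply CartesianMonoidalCategory.hom_ext
  · rw [whiskerLeft_fst, fst_lam, fst_lam]
    refine (lam_congr ?_).trans
      (lam_comp (A := D.prod A) (B := D.prod B) (D := D) (D.X ◁ h) (fst D.X B.X)).symm
    exact (whiskerLeft_fst _ _).symm
  · rw [whiskerLeft_snd, snd_lam, snd_lam]
    refine (lam_comp (A := D.prod A) (B := A) (D := B) (snd D.X A.X) h).trans ?_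
    refine (lam_congr ?_).trans
      (lam_comp (A := D.prod A) (B := D.prod B) (D := B) (D.X ◁ h) (snd D.X B.X)).symm
    exact (whiskerLeft_snd _ _).symm

theorem associator_lam (A B D : CMon C) :
    (α_ (lamObj A) (lamObj B) (lamObj D)).hom =
      lam (A := (A.prod B).prod D) (B := A.prod (B.prod D)) (α_ A.X B.X D.X).hom := by
  apply CartesianMonoidalCategory.hom_ext
  · rw [associator_hom_fst]
    refine (lam_comp (A := (A.prod B).prod D) (B := A.prod B) (D := A) (fst _ _) (fst _ _)).trans ?_
    refine (lam_congr ?_).trans (lam_comp (A := (A.prod B).prod D) (B := A.prod (B.prod D))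
      (D := A) (α_ A.X B.X D.X).hom (fst _ _)).symm
    exact (associator_hom_fst _ _ _).symm
  · apply CartesianMonoidalCategory.hom_ext
    · rw [Category.assoc, associator_hom_snd_fst]
      refine Eq.trans ?_ (Category.assoc _ _ _).symm
      refine (lam_comp (A := (A.prod B).prod D) (B := A.prod B) (D := B) (fst _ _)
        (snd _ _)).trans ?_
      refine Eq.trans ?_ (congrArg (fun z => lam (A := (A.prod B).prod D)
        (B := A.prod (B.prod D)) (α_ A.X B.X D.X).hom ≫ z)
        (lam_comp (A := A.prod (B.prod D)) (B := B.prod D) (D := B) (snd _ _) (fst _ _))).symm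
      refine (lam_congr ?_).trans (lam_comp (A := (A.prod B).prod D) (B := A.prod (B.prod D))
        (D := B) (α_ A.X B.X D.X).hom (snd _ _ ≫ fst _ _)).symm
      exact (associator_hom_snd_fst _ _ _).symm
    · rw [Category.assoc, associator_hom_snd_snd]
      refine Eq.trans ?_ (Category.assoc _ _ _).symm
      refine Eq.trans ?_ (congrArg (fun z => lam (A := (A.prod B).prod D)
        (B := A.prod (B.prod D)) (α_ A.X B.X D.X).hom ≫ z)
        (lam_comp (A := A.prod (B.prod D)) (B := B.prod D) (D := D) (snd _ _) (snd _ _))).symm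
      refine (lam_congr (A := (A.prod B).prod D) (B := D) (h := snd _ _) ?_).trans
        (lam_comp (A := (A.prod B).prod D) (B := A.prod (B.prod D))
        (D := D) (α_ A.X B.X D.X).hom (snd _ _ ≫ snd _ _)).symm
      exact (associator_hom_snd_snd _ _ _).symm

theorem braiding_lam (A B : CMon C) :
    (β_ (lamObj A) (lamObj B)).hom =
      lam (A := A.prod B) (B := B.prod A) (β_ A.X B.X).hom := by
  apply CartesianMonoidalCategory.hom_ext
  · rw [braiding_hom_fst]
    refine (lam_congr ?_).trans (lam_comp (A := A.prod B) (B := B.prod A) (D := B)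
      (β_ A.X B.X).hom (fst B.X A.X)).symm
    exact (braiding_hom_fst _ _).symm
  · rw [braiding_hom_snd]
    refine (lam_congr ?_).trans (lam_comp (A := A.prod B) (B := B.prod A) (D := A)
      (β_ A.X B.X).hom (snd B.X A.X)).symm
    exact (braiding_hom_snd _ _).symm

/-- The commutative monoid `(((A, +, 0), A), (+, π₀ +, 0, …), (0, π₀ 0, 0, …))` in `Faà(C)`. -/
instance lamAdd (A : CMon C) : AddMonObj (lamObj A) where
  zero := lam (A := CMon.unit) (AddMonObj.zero (X := A.X))
  add := lam (A := A.prod A) (AddMonObj.add (X := A.X))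
  zero_add := by
    rw [leftUnitor_hom]
    refine (congrArg (fun z => z ≫ lam (A := A.prod A) (AddMonObj.add (X := A.X)))
      (whiskerRight_lam (A := CMon.unit) (D := A) (AddMonObj.zero (X := A.X)))).trans ?_
    refine (lam_comp (A := CMon.unit.prod A) (B := A.prod A) (D := A) _ _).trans ?_
    refine lam_congr (A := CMon.unit.prod A) (k := snd _ _) ?_
    exact (AddMonObj.zero_add A.X).trans (leftUnitor_hom _)
  add_zero := by
    rw [rightUnitor_hom]
    refine (congrArg (fun z => z ≫ lam (A := A.prod A) (AddMonObj.add (X := A.X)))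
      (whiskerLeft_lam (A := CMon.unit) (D := A) (AddMonObj.zero (X := A.X)))).trans ?_
    refine (lam_comp (A := A.prod CMon.unit) (B := A.prod A) (D := A) _ _).trans ?_
    refine lam_congr (A := A.prod CMon.unit) (k := fst _ _) ?_
    exact (AddMonObj.add_zero A.X).trans (rightUnitor_hom _)
  add_assoc := by
    refine (congrArg (fun z => z ≫ lam (A := A.prod A) (AddMonObj.add (X := A.X)))
      (whiskerRight_lam (A := A.prod A) (D := A) (AddMonObj.add (X := A.X)))).trans ?_
    refine (lam_comp (A := (A.prod A).prod A) (B := A.prod A) (D := A) _ _).trans ?_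
    refine Eq.trans ?_ (congrArg₂ (fun y z => y ≫ z ≫ lam (A := A.prod A)
      (AddMonObj.add (X := A.X))) (associator_lam A A A)
      (whiskerLeft_lam (A := A.prod A) (D := A) (AddMonObj.add (X := A.X)))).symm
    refine Eq.trans ?_ (congrArg (fun y => lam (A := (A.prod A).prod A)
      (B := A.prod (A.prod A)) (α_ A.X A.X A.X).hom ≫ y)
      (lam_comp (A := A.prod (A.prod A)) (B := A.prod A) (D := A) _ _)).symm
    refine Eq.trans ?_ (lam_comp (A := (A.prod A).prod A) (B := A.prod (A.prod A)) (D := A)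
      _ _).symm
    exact lam_congr (AddMonObj.add_assoc A.X)

instance lamAdd_comm (A : CMon C) : IsCommAddMonObj (lamObj A) :=
  ⟨by
    refine (congrArg (fun z => z ≫ lam (A := A.prod A) (AddMonObj.add (X := A.X)))
      (braiding_lam A A)).trans ?_
    refine (lam_comp (A := A.prod A) (B := A.prod A) (D := A) _ _).trans ?_
    exact lam_congr (A := A.prod A) (IsCommAddMonObj.add_comm A.X)⟩

/-- The assignment `L((A, +, 0), X) = (((A, +, 0), A), (+, π₀ +, 0, …), (0, π₀ 0, 0, …))`. -/
abbrev L (P : Faa C) : CMon (Faa C) :=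
  ⟨lamObj P.V⟩

end Faa

end Vectors

section Matchings

open Classical in
/-- A matching between finite sets `s` and `t`, presented as the set of its blocks: the matched
pairs `(some i, some j)`, the unmatched elements `(some i, none)` of `s` and the unmatched elements
`(none, some j)` of `t`. Each element of `s` and each element of `t` lies in exactly one block. -/
def matchings {I J : Type} (s : Finset I) (t : Finset J) :
    Finset (Finset (Option I × Option J)) :=
  (Finset.insertNone s ×ˢ Finset.insertNone t).powerset.filter fun T =>
    (none, none) ∉ T ∧ (∀ i ∈ s, ∃! p, p ∈ T ∧ p.1 = some i) ∧
      (∀ j ∈ t, ∃! p, p ∈ T ∧ p.2 = some j)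

theorem mem_matchings {I J : Type} {s : Finset I} {t : Finset J}
    {T : Finset (Option I × Option J)} :
    T ∈ matchings s t ↔ T ⊆ Finset.insertNone s ×ˢ Finset.insertNone t ∧
      (none, none) ∉ T ∧ (∀ i ∈ s, ∃! p, p ∈ T ∧ p.1 = some i) ∧
      (∀ j ∈ t, ∃! p, p ∈ T ∧ p.2 = some j) := by
  simp [matchings]

/-- The map on blocks induced by injective maps. -/
def blockMap {I J I' J' : Type} (e : I ↪ I') (e' : J ↪ J') :
    Option I × Option J ↪ Option I' × Option J' :=
  e.optionMap.prodMap e'.optionMap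

theorem insertNone_map_product {I J I' J' : Type} (e : I ↪ I') (e' : J ↪ J') (s : Finset I)
    (t : Finset J) : Finset.insertNone (s.map e) ×ˢ Finset.insertNone (t.map e') =
      (Finset.insertNone s ×ˢ Finset.insertNone t).map (blockMap e e') := by
  ext ⟨x, y⟩
  cases x <;> cases y <;>
    simp only [blockMap, Finset.mem_product, Finset.mem_insertNone, Finset.mem_map,
      Function.Embedding.coe_prodMap, Function.Embedding.optionMap_apply, Prod.exists,
      Option.exists, Prod.map_apply, Option.map_none, Option.map_some, Prod.mk.injEq] <;> aesop

theorem blockMap_fst {I J I' J' : Type} (e : I ↪ I') (e' : J ↪ J') (p : Option I × Option J)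
    (i : I) : (blockMap e e' p).1 = some (e i) ↔ p.1 = some i := by
  obtain ⟨x, y⟩ := p
  cases x <;> simp [blockMap]

theorem blockMap_snd {I J I' J' : Type} (e : I ↪ I') (e' : J ↪ J') (p : Option I × Option J)
    (j : J) : (blockMap e e' p).2 = some (e' j) ↔ p.2 = some j := by
  obtain ⟨x, y⟩ := p
  cases y <;> simp [blockMap]

theorem map_mem_matchings {I J I' J' : Type} (e : I ↪ I') (e' : J ↪ J') (s : Finset I)
    (t : Finset J) (T : Finset (Option I × Option J)) :
    T.map (blockMap e e') ∈ matchings (s.map e) (t.map e') ↔ T ∈ matchings s t := by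
  have hn : (none, none) ∈ T.map (blockMap e e') ↔ (none, none) ∈ T :=
    Finset.mem_map' (a := ((none, none) : Option I × Option J)) (blockMap e e')
  have h1 : ∀ i, (∃! p, p ∈ T.map (blockMap e e') ∧ p.1 = some (e i)) ↔
      ∃! p, p ∈ T ∧ p.1 = some i := by
    intro i
    constructor
    · rintro ⟨p, ⟨hp, hpi⟩, hu⟩
      obtain ⟨q, hq, rfl⟩ := Finset.mem_map.1 hp
      refine ⟨q, ⟨hq, (blockMap_fst e e' q i).1 hpi⟩, fun r hr => (blockMap e e').injective ?_⟩
      exact hu _ ⟨Finset.mem_map_of_mem _ hr.1, (blockMap_fst e e' r i).2 hr.2⟩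
    · rintro ⟨q, ⟨hq, hqi⟩, hu⟩
      refine ⟨_, ⟨Finset.mem_map_of_mem _ hq, (blockMap_fst e e' q i).2 hqi⟩, ?_⟩
      rintro p ⟨hp, hpi⟩
      obtain ⟨r, hr, rfl⟩ := Finset.mem_map.1 hp
      rw [hu r ⟨hr, (blockMap_fst e e' r i).1 hpi⟩]
  have h2 : ∀ j, (∃! p, p ∈ T.map (blockMap e e') ∧ p.2 = some (e' j)) ↔
      ∃! p, p ∈ T ∧ p.2 = some j := by
    intro i
    constructor
    · rintro ⟨p, ⟨hp, hpi⟩, hu⟩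
      obtain ⟨q, hq, rfl⟩ := Finset.mem_map.1 hp
      refine ⟨q, ⟨hq, (blockMap_snd e e' q i).1 hpi⟩, fun r hr => (blockMap e e').injective ?_⟩
      exact hu _ ⟨Finset.mem_map_of_mem _ hr.1, (blockMap_snd e e' r i).2 hr.2⟩
    · rintro ⟨q, ⟨hq, hqi⟩, hu⟩
      refine ⟨_, ⟨Finset.mem_map_of_mem _ hq, (blockMap_snd e e' q i).2 hqi⟩, ?_⟩
      rintro p ⟨hp, hpi⟩
      obtain ⟨r, hr, rfl⟩ := Finset.mem_map.1 hp
      rw [hu r ⟨hr, (blockMap_snd e e' r i).1 hpi⟩]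
  rw [mem_matchings, mem_matchings, insertNone_map_product, Finset.map_subset_map, hn]
  simp only [Finset.forall_mem_map, h1, h2]

theorem sum_matchings_map {M : Type*} [AddCommMonoid M] {I J I' J' : Type} (e : I ↪ I')
    (e' : J ↪ J') (s : Finset I) (t : Finset J) (G : Finset (Option I' × Option J') → M) :
    ∑ T ∈ matchings (s.map e) (t.map e'), G T =
      ∑ T ∈ matchings s t, G (T.map (blockMap e e')) := by
  symm
  refine Finset.sum_bij (fun T _ => T.map (blockMap e e'))
    (fun T hT => (map_mem_matchings e e' s t T).2 hT)
    (fun T _ T' _ h => Finset.map_injective _ h) (fun T hT => ?_) (fun _ _ => rfl)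
  have h0 : T ⊆ (Finset.insertNone s ×ˢ Finset.insertNone t).map (blockMap e e') := by
    intro ⟨x, y⟩ hp
    rw [← insertNone_map_product]
    exact (mem_matchings.1 hT).1 hp
  obtain ⟨U, -, rfl⟩ := Finset.subset_map_iff.1 h0
  exact ⟨U, (map_mem_matchings e e' s t U).1 hT, rfl⟩

/-- The value attached to a block of a matching. -/
def blockVal {M : Type*} [Zero M] {I J : Type} (c : I → J → M) (b : I → M) (a : J → M) :
    Option I × Option J → M
  | (some i, some j) => c i j
  | (some i, none) => b i
  | (none, some j) => a j
  | (none, none) => 0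

theorem blockVal_blockMap {M : Type*} [Zero M] {I J I' J' : Type} (e : I ↪ I') (e' : J ↪ J')
    (c : I' → J' → M) (b : I' → M) (a : J' → M) (p : Option I × Option J) :
    blockVal c b a (blockMap e e' p) =
      blockVal (fun i j => c (e i) (e' j)) (fun i => b (e i)) (fun j => a (e' j)) p := by
  obtain ⟨x, y⟩ := p
  cases x <;> cases y <;> rfl

end Matchings

section Comultiplication

variable {C : Type u} [Category.{v} C] [CartesianMonoidalCategory C] [BraidedCategory C]

namespace Faa
namespace Hom

variable {P Q R S : Faa C}

/-- The value `f₁(b, x)`. -/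
def eval₁ (f : Hom P Q) {Γ : C} (b : Γ ⟶ P.V.X) (x : Γ ⟶ P.pt) : Γ ⟶ Q.V.X :=
  lift b x ≫ f.part 1 one_pos

theorem comp_eval₁ (f : Hom P Q) {Δ Γ : C} (h : Δ ⟶ Γ) (b : Γ ⟶ P.V.X) (x : Γ ⟶ P.pt) :
    h ≫ f.eval₁ b x = f.eval₁ (h ≫ b) (h ≫ x) :=
  (Category.assoc _ _ _).symm.trans
    (congrArg (fun z => z ≫ f.part 1 one_pos) (comp_lift h b x))

theorem eval₁_add (f : Hom P Q) {Γ : C} (b c : Γ ⟶ P.V.X) (x : Γ ⟶ P.pt) :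
    f.eval₁ (b + c) x = f.eval₁ b x + f.eval₁ c x := by
  have := f.eval_add (s := {()}) (i := ()) (a := fun _ => b + c) (b := fun _ => b)
    (c := fun _ => c) (by simp) x rfl (fun j _ hj => absurd rfl hj) (fun j _ hj => absurd rfl hj)
  simp only [eval_singleton] at this
  exact this

theorem eval₁_zero (f : Hom P Q) {Γ : C} (x : Γ ⟶ P.pt) :
    f.eval₁ (0 : Γ ⟶ P.V.X) x = 0 := by
  have := f.eval_eq_zero (s := {()}) (i := ()) (a := fun _ => (0 : Γ ⟶ P.V.X)) (by simp) x rfl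
  simp only [eval_singleton] at this
  exact this

/-- The morphism `f` has the form `(u, π₀ h, 0, 0, …)`. -/
def IsLinear (f : Hom P Q) : Prop :=
  ∃ (u : P.pt ⟶ Q.pt) (h : P.V.X ⟶ Q.V.X) (_ : IsAddMonHom h), f = linear u h

theorem IsLinear.eval_comp {g : Hom Q R} (hg : g.IsLinear) (f : Hom P Q) {Γ : C} {I : Type}
    (s : Finset I) (a : I → (Γ ⟶ P.V.X)) (x : Γ ⟶ P.pt) (y : Γ ⟶ Q.pt) :
    (f.comp g).eval s a x = g.eval₁ (f.eval s a x) y := by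
  obtain ⟨u, h, _, rfl⟩ := hg
  rw [eval_comp_linear]
  have := linear_eval_singleton u h () (fun _ => f.eval s a x) y
  simp only [eval_singleton] at this
  exact this.symm

theorem IsLinear.comp {f : Hom P Q} {g : Hom Q R} (hf : f.IsLinear) (hg : g.IsLinear) :
    (f.comp g).IsLinear := by
  obtain ⟨u, h, _, rfl⟩ := hf
  obtain ⟨u', h', _, rfl⟩ := hg
  refine ⟨u ≫ u', h ≫ h', inferInstance, ext_eval rfl fun Γ n hn a x => ?_⟩
  rw [eval_comp_linear]
  by_cases h1 : n = 1
  · subst h1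
    have e : (Finset.univ : Finset (Fin 1)) = {0} := rfl
    rw [e, linear_eval_singleton, linear_eval_singleton, Category.assoc]
  · have hc : (Finset.univ : Finset (Fin n)).card ≠ 1 := by simpa using h1
    rw [linear_eval_ne_one _ _ _ hc, linear_eval_ne_one _ _ _ hc]
    exact AddMonObj.zero_comp h'

theorem proj₁_isLinear (P Q : Faa C) : IsLinear (proj₁ P Q) := ⟨_, _, inferInstance, rfl⟩

theorem proj₂_isLinear (P Q : Faa C) : IsLinear (proj₂ P Q) := ⟨_, _, inferInstance, rfl⟩

theorem id_isLinear (Q : Faa C) : IsLinear (𝟙 Q : Q ⟶ Q) := ⟨_, _, inferInstance, rfl⟩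

theorem vbase_isLinear (P Q : Faa C) (n : ℕ) : IsLinear (vbase P Q n) := by
  induction n with
  | zero => exact id_isLinear Q
  | succ n ih => exact IsLinear.comp (f := proj₂ P (vec P Q n)) (proj₂_isLinear _ _) ih

theorem vproj_isLinear (P Q : Faa C) (n : ℕ) (j : Fin n) : IsLinear (vproj P Q n j) := by
  induction n with
  | zero => exact j.elim0
  | succ n ih =>
    refine Fin.cases ?_ (fun j => ?_) j
    · exact proj₁_isLinear P (vec P Q n)
    · exact IsLinear.comp (f := proj₂ P (vec P Q n)) (proj₂_isLinear _ _) (ih j)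

/-- For directions `v i` (`i ∈ s`) at the point `w` of `L₀(P)ⁿ × P`, with coordinates
`a_j`, `x` of `w` and `c_ij`, `b_i` of `v i` (`j < n`), the sum
`∑ f_k((c_ij : i, j matched), (b_i : i unmatched), (a_j : j unmatched); x)`
over all matchings between `s` and `{0, …, n - 1}`, where `k` is the number of blocks. -/
def deltaFam (f : Hom P Q) (n : ℕ) {Γ : C} {I : Type} (s : Finset I)
    (v : I → (Γ ⟶ (vec (lamObj P.V) P n).V.X)) (w : Γ ⟶ (vec (lamObj P.V) P n).pt) : Γ ⟶ Q.V.X :=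
  ∑ T ∈ matchings s (Finset.univ : Finset (Fin n)),
    f.eval T (blockVal (fun i j => eval₁ (vproj (lamObj P.V) P n j) (v i) w)
      (fun i => eval₁ (vbase (lamObj P.V) P n) (v i) w)
      (fun j => w ≫ Hom.base (vproj (lamObj P.V) P n j)))
      (w ≫ Hom.base (vbase (lamObj P.V) P n))

theorem exists_block {I J : Type} {s : Finset I} {t : Finset J} {T : Finset (Option I × Option J)}
    (hT : T ∈ matchings s t) {i : I} (hi : i ∈ s) :
    ∃ y, (some i, y) ∈ T ∧ ∀ p ∈ T, p ≠ (some i, y) → p.1 ≠ some i := by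
  obtain ⟨⟨x, y⟩, ⟨hp, hx⟩, hu⟩ := (mem_matchings.1 hT).2.2.1 i hi
  obtain rfl : x = some i := hx
  exact ⟨y, hp, fun p hpT hne hpi => hne (hu p ⟨hpT, hpi⟩)⟩

theorem exists_block' {I J : Type} {s : Finset I} {t : Finset J} {T : Finset (Option I × Option J)}
    (hT : T ∈ matchings s t) {j : J} (hj : j ∈ t) :
    ∃ x, (x, some j) ∈ T ∧ ∀ p ∈ T, p ≠ (x, some j) → p.2 ≠ some j := by
  obtain ⟨⟨x, y⟩, ⟨hp, hy⟩, hu⟩ := (mem_matchings.1 hT).2.2.2 j hj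
  obtain rfl : y = some j := hy
  exact ⟨x, hp, fun p hpT hne hpi => hne (hu p ⟨hpT, hpi⟩)⟩

/-- The component `[δ(f)]ₙ : L₀(P)ⁿ × P ⟶ L₀(Q)` of `δ(f)`, a morphism of `Faà(C)`. Its component
`([δ(f)]ₙ)_*` is `fₙ`. -/
def deltaPart (f : Hom P Q) (n : ℕ) (hn : 0 < n) : vec (lamObj P.V) P n ⟶ (lamObj Q.V) :=
  ofFamily (P := vec (lamObj P.V) P n) (Q := (lamObj Q.V))
    (vlift n (fun j => Hom.base (vproj (lamObj P.V) P n j)) (Hom.base (vbase (lamObj P.V) P n)) ≫ f.part n hn)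
    (fun s v w => deltaFam f n s v w)
    (by
      intro Δ Γ I _ h s v w
      simp only [deltaFam]
      refine (comp_sum h _ _).trans (Finset.sum_congr rfl fun T _ => ?_)
      rw [comp_eval, Category.assoc]
      refine eval_congr f _ fun p _ => ?_
      obtain ⟨x, y⟩ := p
      cases x <;> cases y
      · exact comp_zero h
      · exact (Category.assoc _ _ _).symm
      · exact comp_eval₁ _ _ _ _
      · exact comp_eval₁ _ _ _ _)
    (by
      intro Γ I K _ _ s e v w
      simp only [deltaFam]
      have hu : (Finset.univ : Finset (Fin n)) =
        Finset.univ.map (Function.Embedding.refl (Fin n)) := by simp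
      conv_lhs => rw [hu, sum_matchings_map]
      refine Finset.sum_congr rfl fun T _ => ?_
      rw [eval_map]
      simp only [blockVal_blockMap]
      rfl)
    (by
      intro Γ I _ s i hi a b c x h hb hc
      simp only [deltaFam]
      refine Eq.trans ?_ Finset.sum_add_distrib
      refine Finset.sum_congr rfl fun T hT => ?_
      obtain ⟨y, hy, hne⟩ := exists_block hT hi
      have hother : ∀ d : I → (Γ ⟶ (vec (lamObj P.V) P n).V.X), (∀ j, j ≠ i → d j = a j) →
          ∀ p ∈ T, p ≠ (some i, y) →
          blockVal (fun i j => eval₁ (vproj (lamObj P.V) P n j) (d i) x)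
            (fun i => eval₁ (vbase (lamObj P.V) P n) (d i) x)
            (fun j => x ≫ Hom.base (vproj (lamObj P.V) P n j)) p =
          blockVal (fun i j => eval₁ (vproj (lamObj P.V) P n j) (a i) x)
            (fun i => eval₁ (vbase (lamObj P.V) P n) (a i) x)
            (fun j => x ≫ Hom.base (vproj (lamObj P.V) P n j)) p := by
        intro d hd p hp hpne
        have := hne p hp hpne
        obtain ⟨x', y'⟩ := p
        cases x' with
        | none => cases y' <;> rfl
        | some k =>
          have hk : d k = a k := hd k (by rintro rfl; exact this rfl)
          cases y' <;> (simp only [blockVal]; rw [hk])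
      refine f.eval_add hy _ ?_ (hother b hb) (hother c hc)
      cases y with
      | none =>
        simp only [blockVal, h]
        exact eval₁_add (vbase (lamObj P.V) P n) _ _ _
      | some j =>
        simp only [blockVal, h]
        exact eval₁_add (vproj (lamObj P.V) P n j) _ _ _)
    (by
      intro Γ I _ s i hi a x h
      refine Finset.sum_eq_zero fun T hT => ?_
      obtain ⟨y, hy, -⟩ := exists_block hT hi
      refine f.eval_eq_zero hy _ ?_
      cases y with
      | none =>
        simp only [blockVal, h]
        exact eval₁_zero (vbase (lamObj P.V) P n) _
      | some j =>
        simp only [blockVal, h]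
        exact eval₁_zero (vproj (lamObj P.V) P n j) _)

theorem vlift_deltaPart_base (f : Hom P Q) (n : ℕ) (hn : 0 < n) {Z : Faa C}
    (p : Fin n → (Z ⟶ (lamObj P.V))) (q : Z ⟶ P) :
    Hom.base (vlift n p q ≫ f.deltaPart n hn) =
      vlift n (fun j => Hom.base (p j)) (Hom.base q) ≫ f.part n hn := by
  change Hom.base (vlift n p q) ≫ vlift n _ _ ≫ f.part n hn = _
  rw [← Category.assoc, comp_vlift]
  congr 2
  · funext j
    exact congrArg Hom.base (vlift_vproj n p q j)
  · exact congrArg Hom.base (vlift_vbase n p q)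

theorem vlift_deltaPart_eval (f : Hom P Q) (n : ℕ) (hn : 0 < n) {Z : Faa C}
    (p : Fin n → (Z ⟶ (lamObj P.V))) (q : Z ⟶ P) {Γ : C} {I : Type} [DecidableEq I] (s : Finset I)
    (hs : s.Nonempty) (v : I → (Γ ⟶ Z.V.X)) (w : Γ ⟶ Z.pt) :
    Hom.eval (vlift n p q ≫ f.deltaPart n hn) s v w =
      ∑ π : Finpartition s, ∑ T ∈ matchings π.parts (Finset.univ : Finset (Fin n)),
        f.eval T (blockVal (fun B j => Hom.eval (p j) B v w) (fun B => Hom.eval q B v w)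
          (fun j => w ≫ Hom.base (p j))) (w ≫ Hom.base q) := by
  refine (eval_comp (vlift n p q) (f.deltaPart n hn) s v w).trans ?_
  refine Finset.sum_congr rfl fun π _ => ?_
  refine (ofFamily_eval _ _ _ _ _ _ π.parts (π.parts_nonempty hs.ne_empty) _ _).trans ?_
  refine Finset.sum_congr rfl fun T _ => ?_
  have hb : (w ≫ Hom.base (vlift n p q)) ≫ Hom.base (vbase (lamObj P.V) P n) = w ≫ Hom.base q := by
    rw [Category.assoc]
    exact congrArg (fun z => w ≫ Hom.base z) (vlift_vbase n p q)
  rw [hb]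
  refine eval_congr f _ fun z _ => ?_
  obtain ⟨x, y⟩ := z
  cases x <;> cases y
  · rfl
  · refine (Category.assoc _ _ _).trans ?_
    exact congrArg (fun z => w ≫ Hom.base z) (vlift_vproj n p q _)
  · refine ((vbase_isLinear (lamObj P.V) P n).eval_comp (vlift n p q) _ v w _).symm.trans ?_
    exact congrArg (fun z => Hom.eval z _ v w) (vlift_vbase n p q)
  · refine ((vproj_isLinear (lamObj P.V) P n _).eval_comp (vlift n p q) _ v w _).symm.trans ?_
    exact congrArg (fun z => Hom.eval z _ v w) (vlift_vproj n p q _)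

end Hom
end Faa

end Comultiplication

section Differential

variable {C : Type u} [Category.{v} C] [CartesianMonoidalCategory C] [BraidedCategory C]

namespace Faa

open Hom

variable {P Q R S : Faa C}

theorem add_base {Z P : Faa C} (p q : Z ⟶ (L P).X) :
    Hom.base (p + q) = Hom.base p + Hom.base q := rfl

theorem add_eval {Z P : Faa C} (p q : Z ⟶ (L P).X) {Γ : C} {I : Type} (s : Finset I)
    (v : I → (Γ ⟶ Z.V.X)) (w : Γ ⟶ Z.pt) :
    Hom.eval (p + q) s v w = Hom.eval p s v w + Hom.eval q s v w := by
  refine (eval_comp_lam (A := P.V.prod P.V) (B := P.V) (lift p q) _ s v w).trans ?_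
  exact congrArg (fun z => z ≫ AddMonObj.add (X := P.V.X)) (pair_eval p q s v w)

theorem zero_base {Z P : Faa C} : Hom.base (0 : Z ⟶ (L P).X) = (0 : Z.pt ⟶ P.V.X) := rfl

theorem zero_eval {Z P : Faa C} {Γ : C} {I : Type} (s : Finset I)
    (v : I → (Γ ⟶ Z.V.X)) (w : Γ ⟶ Z.pt) :
    Hom.eval (0 : Z ⟶ (L P).X) s v w = 0 := by
  refine (eval_comp_lam (A := CMon.unit) (B := P.V) (toUnit Z) _ s v w).trans ?_
  exact congrArg (fun z => z ≫ AddMonObj.zero (X := P.V.X)) (toUnit_unique _ (toUnit Γ))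

/-- The comultiplication on objects: `δ((A, +, 0), X) = (L((A, +, 0), X), ((A, +, 0), X))`. -/
abbrev deltaObj (P : Faa C) : Faa (Faa C) := ⟨L P, P⟩

/-- The comultiplication `δ : Faà(C) ⟶ Faà(Faà(C))` on morphisms: `δ(f)_* = f`, and `δ(f)ₙ` is
`deltaPart f n`. -/
def delta (f : P ⟶ Q) : deltaObj P ⟶ deltaObj Q :=
  Hom.mk (P := deltaObj P) (Q := deltaObj Q) f (fun n hn => deltaPart f n hn)
    (by
      intro n hn Z p q τ
      refine ext_eval ?_ fun Γ m hm v w => ?_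
      · rw [vlift_deltaPart_base, vlift_deltaPart_base]
        exact f.part_symm n hn _ (fun j => Hom.base (p j)) (Hom.base q) τ
      · have hs : (Finset.univ : Finset (Fin m)).Nonempty := ⟨⟨0, hm⟩, Finset.mem_univ _⟩
        rw [vlift_deltaPart_eval _ _ _ _ _ _ hs, vlift_deltaPart_eval _ _ _ _ _ _ hs]
        refine Finset.sum_congr rfl fun π _ => ?_
        have hu : (Finset.univ : Finset (Fin n)) = Finset.univ.map τ.toEmbedding := by simp
        have hp : π.parts = π.parts.map (Function.Embedding.refl _) := by simp
        conv_rhs => rw [hu, hp, sum_matchings_map]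
        refine Finset.sum_congr rfl fun T _ => ?_
        rw [Hom.eval_map]
        simp only [blockVal_blockMap]
        rfl)
    (by
      intro n hn Z p q i b c
      refine ext_eval ?_ fun Γ m hm v w => ?_
      · rw [add_base, vlift_deltaPart_base, vlift_deltaPart_base, vlift_deltaPart_base]
        have key : ∀ d : Z ⟶ (L P).X, (fun j => Hom.base (Function.update p i d j)) =
            Function.update (fun j => Hom.base (p j)) i (Hom.base d) := by
          intro d
          funext j
          by_cases hj : j = i
          · subst hj; simp
          · simp [hj]
        rw [key, key, key, add_base]
        exact f.part_add n hn _ _ _ i _ _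
      · have hs : (Finset.univ : Finset (Fin m)).Nonempty := ⟨⟨0, hm⟩, Finset.mem_univ _⟩
        rw [add_eval, vlift_deltaPart_eval _ _ _ _ _ _ hs, vlift_deltaPart_eval _ _ _ _ _ _ hs,
          vlift_deltaPart_eval _ _ _ _ _ _ hs]
        refine Eq.trans ?_ Finset.sum_add_distrib
        refine Finset.sum_congr rfl fun π _ => ?_
        refine Eq.trans ?_ Finset.sum_add_distrib
        refine Finset.sum_congr rfl fun T hT => ?_
        obtain ⟨x, hx, hne⟩ := exists_block' hT (Finset.mem_univ i)
        have hother : ∀ d : Z ⟶ (L P).X, ∀ z ∈ T, z ≠ (x, some i) →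
            blockVal (fun B j => Hom.eval (Function.update p i d j) B v w)
              (fun B => Hom.eval q B v w)
              (fun j => w ≫ Hom.base (Function.update p i d j)) z =
            blockVal (fun B j => Hom.eval (Function.update p i (b + c) j) B v w)
              (fun B => Hom.eval q B v w)
              (fun j => w ≫ Hom.base (Function.update p i (b + c) j)) z := by
          intro d z hz hzne
          have := hne z hz hzne
          obtain ⟨x', y'⟩ := z
          cases y' with
          | none => cases x' <;> rfl
          | some k =>
            have hk : k ≠ i := by rintro rfl; exact this rfl
            cases x' <;> simp only [blockVal, Function.update_of_ne hk]
        refine f.eval_add hx _ ?_ (hother b) (hother c)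
        cases x with
        | none =>
          simp only [blockVal, Function.update_self]
          exact comp_add w _ _
        | some B =>
          simp only [blockVal, Function.update_self]
          exact add_eval b c B v w)
    (by
      intro n hn Z p q i
      refine ext_eval ?_ fun Γ m hm v w => ?_
      · rw [zero_base, vlift_deltaPart_base]
        have key : (fun j => Hom.base (Function.update p i 0 j)) =
            Function.update (fun j => Hom.base (p j)) i 0 := by
          funext j
          by_cases hj : j = i
          · subst hj; simp [zero_base]
          · simp [hj]
        rw [key]
        exact f.part_zero n hn _ _ _ i
      · have hs : (Finset.univ : Finset (Fin m)).Nonempty := ⟨⟨0, hm⟩, Finset.mem_univ _⟩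
        rw [zero_eval, vlift_deltaPart_eval _ _ _ _ _ _ hs]
        refine Finset.sum_eq_zero fun π _ => Finset.sum_eq_zero fun T hT => ?_
        obtain ⟨x, hx, -⟩ := exists_block' hT (Finset.mem_univ i)
        refine f.eval_eq_zero hx _ ?_
        cases x with
        | none =>
          simp only [blockVal, Function.update_self, zero_base]
          exact comp_zero w
        | some B =>
          simp only [blockVal, Function.update_self]
          exact zero_eval B v w)

/-- The differential `D(f) = [δ(f)]₁`. -/
def D (f : P ⟶ Q) : (L P).X ⊗ P ⟶ (L Q).X :=
  Hom.part (delta f) 1 one_pos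

end Faa

end Differential

section GeneralizedCartesianDifferential

variable {C : Type u} [Category.{v} C] [CartesianMonoidalCategory C] [BraidedCategory C]

/-- The identity map between the underlying objects of equal commutative monoids. -/
def CMon.cast {A B : CMon C} (h : A = B) : A.X ⟶ B.X := eqToHom (congrArg CMon.X h)

/-- Generalized Cartesian differential categories: a Cartesian category `C` with, for each object
`X`, a commutative monoid `L X` (with underlying object `L₀(X) = (L X).X`), compatible with
products and satisfying `L(L₀(X)) = L(X)`, and, for each `f : X ⟶ Y`, a map
`D f : L₀(X) × X ⟶ L₀(Y)`, such that the axioms CD.1 to CD.7 hold. Composition `f ≫ g` is in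
diagrammatic order, and the maps `CMon.cast` are the identities coming from the equations between
objects. -/
structure IsGenCartDiff (L : C → CMon C)
    (D : ∀ {X Y : C}, (X ⟶ Y) → ((L X).X ⊗ X ⟶ (L Y).X)) : Prop where
  /-- `L(L₀(X)) = L(X)`. -/
  L_L : ∀ X : C, L (L X).X = L X
  /-- `L(1) = 1`. -/
  L_unit : L (𝟙_ C) = CMon.unit
  /-- `L(X × Y) = L(X) × L(Y)`. -/
  L_prod : ∀ X Y : C, L (X ⊗ Y) = (L X).prod (L Y)
  /-- CD.1: `D(+_X) = π₀ +_X`. -/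
  cd1_add : ∀ X : C,
    D (AddMonObj.add (X := (L X).X)) ≫ CMon.cast (L_L X) =
      fst _ _ ≫ CMon.cast ((L_prod _ _).trans (congrArg₂ CMon.prod (L_L X) (L_L X))) ≫
        AddMonObj.add (X := (L X).X)
  /-- CD.1: `D(0_X) = π₀ 0_X`. -/
  cd1_zero : ∀ X : C,
    D (AddMonObj.zero (X := (L X).X)) ≫ CMon.cast (L_L X) =
      fst _ _ ≫ CMon.cast L_unit ≫ AddMonObj.zero (X := (L X).X)
  /-- CD.2: `⟨a + b, c⟩ D(f) = ⟨a, c⟩ D(f) + ⟨b, c⟩ D(f)`. -/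
  cd2_add : ∀ {X Y : C} (f : X ⟶ Y) {Γ : C} (a b : Γ ⟶ (L X).X) (c : Γ ⟶ X),
    lift (a + b) c ≫ D f = lift a c ≫ D f + lift b c ≫ D f
  /-- CD.2: `⟨0, a⟩ D(f) = 0`. -/
  cd2_zero : ∀ {X Y : C} (f : X ⟶ Y) {Γ : C} (a : Γ ⟶ X),
    lift (0 : Γ ⟶ (L X).X) a ≫ D f = 0
  /-- CD.3: `D(π₀) = π₀ π₀`. -/
  cd3_fst : ∀ X Y : C, D (fst X Y) = fst _ _ ≫ CMon.cast (L_prod X Y) ≫ fst (L X).X (L Y).X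
  /-- CD.3: `D(π₁) = π₀ π₁`. -/
  cd3_snd : ∀ X Y : C, D (snd X Y) = fst _ _ ≫ CMon.cast (L_prod X Y) ≫ snd (L X).X (L Y).X
  /-- CD.4: `D(⟨f, g⟩) = ⟨D(f), D(g)⟩`. -/
  cd4 : ∀ {X Y Z : C} (f : X ⟶ Y) (g : X ⟶ Z),
    D (lift f g) ≫ CMon.cast (L_prod Y Z) = lift (D f) (D g)
  /-- CD.5: `D(f g) = ⟨D(f), π₁ f⟩ D(g)`. -/
  cd5 : ∀ {X Y Z : C} (f : X ⟶ Y) (g : Y ⟶ Z), D (f ≫ g) = lift (D f) (snd _ _ ≫ f) ≫ D g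
  /-- CD.6: `⟨⟨a, 0⟩, ⟨c, d⟩⟩ D(D(f)) = ⟨a, d⟩ D(f)`. -/
  cd6 : ∀ {X Y : C} (f : X ⟶ Y) {Γ : C} (a c : Γ ⟶ (L X).X) (d : Γ ⟶ X),
    lift (lift a 0 ≫ CMon.cast
        ((L_prod _ _).trans (congrArg (CMon.prod · (L X)) (L_L X))).symm) (lift c d) ≫
      D (D f) ≫ CMon.cast (L_L Y) = lift a d ≫ D f
  /-- CD.7: `⟨⟨0, b⟩, ⟨c, d⟩⟩ D(D(f)) = ⟨⟨0, c⟩, ⟨b, d⟩⟩ D(D(f))`. -/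
  cd7 : ∀ {X Y : C} (f : X ⟶ Y) {Γ : C} (b c : Γ ⟶ (L X).X) (d : Γ ⟶ X),
    lift (lift 0 b ≫ CMon.cast
        ((L_prod _ _).trans (congrArg (CMon.prod · (L X)) (L_L X))).symm) (lift c d) ≫ D (D f) =
    lift (lift 0 c ≫ CMon.cast
        ((L_prod _ _).trans (congrArg (CMon.prod · (L X)) (L_L X))).symm) (lift b d) ≫ D (D f)

/-- All the objects of vectors `L₀(X)` are terminal. -/
def VectorsTerminal (L : C → CMon C) : Prop :=
  ∀ X : C, Nonempty (Limits.IsTerminal (L X).X)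

/-- All the derivatives `D(f)` are the zero maps `! 0 : L₀(X) × X ⟶ L₀(Y)`. -/
def DerivativesZero (L : C → CMon C) (D : ∀ {X Y : C}, (X ⟶ Y) → ((L X).X ⊗ X ⟶ (L Y).X)) :
    Prop :=
  ∀ {X Y : C} (f : X ⟶ Y), D f = toUnit _ ≫ AddMonObj.zero (X := (L Y).X)

/-- The differential structure is trivial: up to isomorphism, `L(X) = 1` for every `X`, and
`D(f) = !` for every `f`. -/
def IsTrivialDiff (L : C → CMon C) (D : ∀ {X Y : C}, (X ⟶ Y) → ((L X).X ⊗ X ⟶ (L Y).X)) : Prop :=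
  VectorsTerminal L ∧ DerivativesZero L D

/-- Up to isomorphism, the terminal object is the only commutative monoid in `C`. -/
def OnlyTrivialCMon (C : Type u) [Category.{v} C] [CartesianMonoidalCategory C]
    [BraidedCategory C] : Prop :=
  ∀ A : CMon C, Nonempty (Limits.IsTerminal A.X)

end GeneralizedCartesianDifferential

end FaaDiBruno

end

/-!
All the derivatives of `⟨p, q⟩ D(f)` are given by one formula (`eval₀_lift_D`). A sum over the
partitions of a finite set `s` of variables and over the partial matchings of the blocks with a
one-element set is a sum over the partitions of `s` with one point added: the block matched with the
element receives the added point, and if the element is unmatched, the added point is a block of its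
own (`sum_matchings_one`). Hence the derivative of `⟨p, q⟩ D(f)` in the variables `s` is the sum, over
the partitions `σ` of `s` and one marked point, of the values of `f` on the blocks of `σ`, where the
block with the mark is evaluated by `p` and the others by `q`. The convention that the empty
derivative of `p` is `p_*`, possible because `p` takes values in an object `((A, +, 0), A)`, makes
the formula hold for `s = ∅` too, where it says `D(f)_* = f₁`.

The chain rule CD.5 is then the associativity of Faà di Bruno composition, that is
`sum_partition_assoc`, for the set `s` and the mark (`D_comp`). For a linear morphism only the
partition with one block contributes, so its derivative is its additive part (`D_linear`); this gives
CD.1 and CD.3, and with the chain rule CD.4. CD.2 is the additivity of `[δ(f)]₁` in its first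
variable. Applied twice, the formula expresses `⟨⟨a, b⟩, ⟨c, d⟩⟩ D(D(f))` by partitions of `s` and two
marks, where a block is evaluated by `a` if it contains both marks, by `b` or `c` if it contains one
of them, and by `d` if it contains none (`eval₀_lift_D_D_eq_sum`). Exchanging the marks exchanges `b`
and `c`, which is CD.7 (`lift_D_D_symm`). If `b = 0`, the two marks must be in the same block, which
leaves the formula for `⟨a, d⟩ D(f)`: this is CD.6 (`lift_D_D_zero`).

The equation `L(P × Q) = L(P) × L(Q)` holds because a monoid structure on a product with additive
projections is unique. For the last two assertions, the derivative of an identity is the projection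
`L₀(P) × P ⟶ L₀(P)`, and every map `p : Z ⟶ A` in `C` is the base of a morphism of `Faà(C)` to
`((A, +, 0), A)`; so if all derivatives vanish, the objects `L₀(P)` are terminal, and if these are
terminal, every commutative monoid in `C` is trivial.
-/

noncomputable section

namespace FaaDiBruno

open scoped MonObj

/-! ### Partitions with a marked point -/

section MarkedPartitions

variable {I : Type} [DecidableEq I]

/-- A block of a matching between a family of subsets of `I` and a one-element set, seen as a subset
of `Option I`: the added point `none` stands for the element of the one-element set. -/
def mergeBlock (p : Option (Finset I) × Option (Fin 1)) : Finset (Option I) :=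
  (p.1.elim ∅ fun B => B.map Function.Embedding.some) ∪ if p.2.isSome then {none} else ∅

/-- The inverse of `mergeBlock`, on blocks without the value `some ∅`. -/
def splitBlock (B : Finset (Option I)) : Option (Finset I) × Option (Fin 1) :=
  (if B.eraseNone.Nonempty then some B.eraseNone else none, if none ∈ B then some 0 else none)

theorem some_mem_mergeBlock {p : Option (Finset I) × Option (Fin 1)} {i : I} :
    some i ∈ mergeBlock p ↔ ∃ B, p.1 = some B ∧ i ∈ B := by
  obtain ⟨_ | B, _ | j⟩ := p <;> simp [mergeBlock]

theorem none_mem_mergeBlock {p : Option (Finset I) × Option (Fin 1)} :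
    none ∈ mergeBlock p ↔ p.2 = some 0 := by
  obtain ⟨_ | B, _ | j⟩ := p <;> simp [mergeBlock, Fin.fin_one_eq_zero]

theorem mergeBlock_splitBlock (B : Finset (Option I)) : mergeBlock (splitBlock B) = B := by
  ext x
  cases x with
  | none => rw [none_mem_mergeBlock]; simp [splitBlock]
  | some i =>
    rw [some_mem_mergeBlock]
    simp only [splitBlock]
    constructor
    · rintro ⟨R, hR, hi⟩
      split_ifs at hR
      obtain rfl := Option.some.inj hR
      exact Finset.mem_eraseNone.1 hi
    · intro hi
      have h := Finset.mem_eraseNone.2 hi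
      exact ⟨_, if_pos ⟨i, h⟩, h⟩

theorem splitBlock_mergeBlock {p : Option (Finset I) × Option (Fin 1)} (hp : p.1 ≠ some ∅) :
    splitBlock (mergeBlock p) = p := by
  have he : (mergeBlock p).eraseNone = p.1.elim ∅ id := by
    ext i
    rw [Finset.mem_eraseNone, some_mem_mergeBlock]
    obtain ⟨_ | B, y⟩ := p <;> simp
  apply Prod.ext
  · simp only [splitBlock, he]
    obtain ⟨_ | B, y⟩ := p
    · simp
    · have hB : B.Nonempty := Finset.nonempty_iff_ne_empty.2 fun h => hp (by rw [h])
      simp [hB]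
  · simp only [splitBlock, none_mem_mergeBlock]
    obtain ⟨x, _ | j⟩ := p <;> simp [Fin.fin_one_eq_zero]

variable {s : Finset I}

theorem fst_ne_some_empty {π : Finpartition s} {T : Finset (Option (Finset I) × Option (Fin 1))}
    (hT : T ∈ matchings π.parts Finset.univ) {p : Option (Finset I) × Option (Fin 1)}
    (hp : p ∈ T) : p.1 ≠ some ∅ := by
  intro h
  have := (Finset.mem_product.1 ((mem_matchings.1 hT).1 hp)).1
  rw [h, Finset.some_mem_insertNone] at this
  exact π.ne_bot this rfl

theorem mergeBlock_injOn {π : Finpartition s} {T : Finset (Option (Finset I) × Option (Fin 1))}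
    (hT : T ∈ matchings π.parts Finset.univ) : Set.InjOn mergeBlock
    (T : Set (Option (Finset I) × Option (Fin 1))) :=
  fun p hp q hq h => by
    rw [← splitBlock_mergeBlock (fst_ne_some_empty hT hp), h,
      splitBlock_mergeBlock (fst_ne_some_empty hT hq)]

theorem mem_parts_iff_of_mem_matchings {π : Finpartition s}
    {T : Finset (Option (Finset I) × Option (Fin 1))} (hT : T ∈ matchings π.parts Finset.univ)
    {B : Finset I} : B ∈ π.parts ↔ ∃ y, (some B, y) ∈ T := by
  constructor
  · intro hB
    obtain ⟨y, hy, -⟩ := Faa.Hom.exists_block hT hB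
    exact ⟨y, hy⟩
  · rintro ⟨y, hy⟩
    have := (Finset.mem_product.1 ((mem_matchings.1 hT).1 hy)).1
    exact Finset.some_mem_insertNone.1 this

/-- The partition of `s` together with one more point that is given by a partition of `s` and a
matching of its blocks with that point. -/
def mergePart (π : Finpartition s) (T : Finset (Option (Finset I) × Option (Fin 1)))
    (hT : T ∈ matchings π.parts Finset.univ) : Finpartition (Finset.insertNone s) :=
  Finpartition.ofExistsUnique (T.image mergeBlock)
    (by
      intro R hR x hx
      obtain ⟨p, hp, rfl⟩ := Finset.mem_image.1 hR
      cases x with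
      | none => exact Finset.none_mem_insertNone
      | some i =>
        obtain ⟨B, hB, hi⟩ := some_mem_mergeBlock.1 hx
        have hB' : B ∈ π.parts := (mem_parts_iff_of_mem_matchings hT).2
          ⟨p.2, by rw [← hB]; exact hp⟩
        exact Finset.some_mem_insertNone.2 (π.le hB' hi))
    (by
      intro x hx
      cases x with
      | none =>
        obtain ⟨p, ⟨hp, hp0⟩, hu⟩ := (mem_matchings.1 hT).2.2.2 0 (Finset.mem_univ _)
        refine ⟨mergeBlock p, ⟨Finset.mem_image_of_mem _ hp, none_mem_mergeBlock.2 hp0⟩, ?_⟩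
        rintro R ⟨hR, hn⟩
        obtain ⟨q, hq, rfl⟩ := Finset.mem_image.1 hR
        rw [hu q ⟨hq, none_mem_mergeBlock.1 hn⟩]
      | some i =>
        obtain ⟨B, hB, hi⟩ := π.exists_mem (Finset.some_mem_insertNone.1 hx)
        obtain ⟨p, ⟨hp, hpB⟩, hu⟩ := (mem_matchings.1 hT).2.2.1 B hB
        refine ⟨mergeBlock p, ⟨Finset.mem_image_of_mem _ hp,
          some_mem_mergeBlock.2 ⟨B, hpB, hi⟩⟩, ?_⟩
        rintro R ⟨hR, hn⟩
        obtain ⟨q, hq, rfl⟩ := Finset.mem_image.1 hR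
        obtain ⟨B', hqB, hi'⟩ := some_mem_mergeBlock.1 hn
        have hB' : B' ∈ π.parts := (mem_parts_iff_of_mem_matchings hT).2
          ⟨q.2, by rw [← hqB]; exact hq⟩
        obtain rfl := π.eq_of_mem_parts hB' hB hi' hi
        rw [hu q ⟨hq, hqB⟩])
    (by
      intro h
      obtain ⟨p, hp, hpe⟩ := Finset.mem_image.1 h
      have h2 := splitBlock_mergeBlock (fst_ne_some_empty hT hp)
      rw [hpe] at h2
      have h3 : ((none, none) : Option (Finset I) × Option (Fin 1)) = p := by
        rw [← h2]; simp [splitBlock]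
      exact (mem_matchings.1 hT).2.1 (h3 ▸ hp))

/-- Partitions of `s` with a matching of the blocks with a one-element set are the same thing as
partitions of `s` with one point added. -/
theorem sum_matchings_one {M : Type*} [AddCommMonoid M] (s : Finset I)
    (G : Finset (Finset (Option I)) → M) :
    ∑ π : Finpartition s, ∑ T ∈ matchings π.parts (Finset.univ : Finset (Fin 1)),
      G (T.image mergeBlock) = ∑ σ : Finpartition (Finset.insertNone s), G σ.parts := by
  rw [Finset.sum_sigma']
  refine Finset.sum_bij (fun x hx => mergePart x.1 x.2 (Finset.mem_sigma.1 hx).2)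
    (fun _ _ => Finset.mem_univ _) ?_ ?_ (fun _ _ => rfl)
  · rintro ⟨π, T⟩ hx ⟨π', T'⟩ hx' h
    have hT : T ∈ matchings π.parts Finset.univ := (Finset.mem_sigma.1 hx).2
    have hT' : T' ∈ matchings π'.parts Finset.univ := (Finset.mem_sigma.1 hx').2
    have hi : T.image mergeBlock = T'.image mergeBlock := congrArg Finpartition.parts h
    have key : ∀ {π : Finpartition s} {T : Finset (Option (Finset I) × Option (Fin 1))},
        T ∈ matchings π.parts Finset.univ → (T.image mergeBlock).image splitBlock = T := by
      intro π T hT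
      rw [Finset.image_image]
      refine (Finset.image_congr fun p hp => ?_).trans Finset.image_id
      exact splitBlock_mergeBlock (fst_ne_some_empty hT hp)
    obtain rfl : T = T' := by rw [← key hT, hi, key hT']
    obtain rfl : π = π' := by
      apply Finpartition.ext
      ext B
      exact (mem_parts_iff_of_mem_matchings hT).trans (mem_parts_iff_of_mem_matchings hT').symm
    rfl
  · intro σ _
    have hparts : ∀ {B : Finset I}, B ∈ (σ.parts.image Finset.eraseNone).erase ∅ ↔
        B.Nonempty ∧ ∃ R ∈ σ.parts, R.eraseNone = B := by
      intro B
      rw [Finset.mem_erase, Finset.mem_image, Finset.nonempty_iff_ne_empty]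
    let π : Finpartition s := Finpartition.ofExistsUnique ((σ.parts.image Finset.eraseNone).erase ∅)
      (by
        intro B hB i hi
        obtain ⟨-, R, hR, rfl⟩ := hparts.1 hB
        exact Finset.some_mem_insertNone.1 (σ.le hR (Finset.mem_eraseNone.1 hi)))
      (by
        intro i hi
        obtain ⟨R, hR, hiR⟩ := σ.exists_mem (Finset.some_mem_insertNone.2 hi)
        have hiR' := Finset.mem_eraseNone.2 hiR
        refine ⟨R.eraseNone, ⟨hparts.2 ⟨⟨i, hiR'⟩, R, hR, rfl⟩, hiR'⟩, ?_⟩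
        rintro B ⟨hB, hiB⟩
        obtain ⟨-, R', hR', rfl⟩ := hparts.1 hB
        rw [σ.eq_of_mem_parts hR' hR (Finset.mem_eraseNone.1 hiB) hiR])
      (by simp)
    have hπ : ∀ {B : Finset I}, B ∈ π.parts ↔ B.Nonempty ∧ ∃ R ∈ σ.parts, R.eraseNone = B :=
      hparts
    have himg : (σ.parts.image splitBlock).image mergeBlock = σ.parts := by
      rw [Finset.image_image]
      exact (Finset.image_congr fun R _ => mergeBlock_splitBlock R).trans Finset.image_id
    have hfst : ∀ {R : Finset (Option I)} {B : Finset I}, (splitBlock R).1 = some B →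
        R.eraseNone = B ∧ B.Nonempty := by
      intro R B h
      simp only [splitBlock] at h
      split_ifs at h with h0
      obtain rfl := Option.some.inj h
      exact ⟨rfl, h0⟩
    have hT : σ.parts.image splitBlock ∈ matchings π.parts Finset.univ := by
      refine mem_matchings.2 ⟨?_, ?_, ?_, ?_⟩
      · intro p hp
        obtain ⟨R, hR, rfl⟩ := Finset.mem_image.1 hp
        refine Finset.mem_product.2 ⟨Finset.mem_insertNone.2 fun B hB => ?_,
          Finset.mem_insertNone.2 fun _ _ => Finset.mem_univ _⟩
        obtain ⟨h1, h2⟩ := hfst hB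
        exact hπ.2 ⟨h2, R, hR, h1⟩
      · intro h
        obtain ⟨R, hR, h⟩ := Finset.mem_image.1 h
        have := mergeBlock_splitBlock R
        rw [h] at this
        exact σ.ne_bot hR (this.symm.trans (by simp [mergeBlock]))
      · intro B hB
        obtain ⟨hne, R, hR, rfl⟩ := hπ.1 hB
        refine ⟨splitBlock R, ⟨Finset.mem_image_of_mem _ hR, if_pos hne⟩, ?_⟩
        rintro p ⟨hp, hpB⟩
        obtain ⟨R', hR', rfl⟩ := Finset.mem_image.1 hp
        obtain ⟨i, hi⟩ := hne
        have hi' : i ∈ R'.eraseNone := by rw [(hfst hpB).1]; exact hi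
        rw [σ.eq_of_mem_parts hR' hR (Finset.mem_eraseNone.1 hi') (Finset.mem_eraseNone.1 hi)]
      · intro j _
        obtain rfl := Fin.fin_one_eq_zero j
        obtain ⟨R, hR, hn⟩ := σ.exists_mem (Finset.none_mem_insertNone (s := s))
        refine ⟨splitBlock R, ⟨Finset.mem_image_of_mem _ hR, if_pos hn⟩, ?_⟩
        rintro p ⟨hp, hp0⟩
        obtain ⟨R', hR', rfl⟩ := Finset.mem_image.1 hp
        have hn' : none ∈ R' := by
          by_contra h
          simp [splitBlock, h] at hp0
        rw [σ.eq_of_mem_parts hR' hR hn' hn]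
    exact ⟨⟨π, _⟩, Finset.mem_sigma.2 ⟨Finset.mem_univ _, hT⟩, Finpartition.ext himg⟩

/-- Reindexing of a sum over the partitions of a finite set along an injective map. -/
theorem sum_finpartition_map {M : Type*} [AddCommMonoid M] {K : Type} [DecidableEq K] (e : I ↪ K)
    (s : Finset I) (G : Finset (Finset K) → M) :
    ∑ σ : Finpartition (s.map e), G σ.parts =
      ∑ σ : Finpartition s, G (σ.parts.map (Finset.mapEmbedding e).toEmbedding) :=
  (Fintype.sum_bijective (mapPart e) (mapPart_bijective e s) _ _ fun _ => rfl).symm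

end MarkedPartitions

/-! ### First derivatives and the chain rule -/

section Jets

variable {C : Type u} [Category.{v} C] [CartesianMonoidalCategory C] [BraidedCategory C]

namespace Faa

open Hom

variable {P Q R Z : Faa C} {A B : CMon C}

/-- The values of a morphism `p` to an object `((A, +, 0), A)`, including `p_*` as the value on the
empty family: this makes sense because `p_*` and all the `pₙ` have the same codomain. -/
def eval₀ (p : Z ⟶ lamObj A) {Γ : C} {I : Type} (s : Finset I) (v : I → (Γ ⟶ Z.V.X))
    (w : Γ ⟶ Z.pt) : Γ ⟶ A.X :=
  if s.Nonempty then Hom.eval p s v w else w ≫ Hom.base p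

theorem eval₀_empty (p : Z ⟶ lamObj A) {Γ : C} {I : Type} (v : I → (Γ ⟶ Z.V.X))
    (w : Γ ⟶ Z.pt) : eval₀ p ∅ v w = w ≫ Hom.base p := by
  simp [eval₀]

theorem eval₀_of_nonempty (p : Z ⟶ lamObj A) {Γ : C} {I : Type} {s : Finset I} (hs : s.Nonempty)
    (v : I → (Γ ⟶ Z.V.X)) (w : Γ ⟶ Z.pt) : eval₀ p s v w = Hom.eval p s v w :=
  if_pos hs

theorem ext_eval₀ {p q : Z ⟶ lamObj A}
    (h : ∀ (Γ : C) (n : ℕ) (v : Fin n → (Γ ⟶ Z.V.X)) (w : Γ ⟶ Z.pt),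
      eval₀ p Finset.univ v w = eval₀ q Finset.univ v w) : p = q := by
  refine ext_eval ?_ fun Γ n hn v w => ?_
  · have := h Z.pt 0 Fin.elim0 (𝟙 _)
    rw [Finset.univ_eq_empty, eval₀_empty, eval₀_empty] at this
    simpa only [Category.id_comp] using this
  · have hs : (Finset.univ : Finset (Fin n)).Nonempty := ⟨⟨0, hn⟩, Finset.mem_univ _⟩
    have := h Γ n v w
    rwa [eval₀_of_nonempty p hs, eval₀_of_nonempty q hs] at this

theorem eval₀_zero {Γ : C} {I : Type} (s : Finset I) (v : I → (Γ ⟶ Z.V.X)) (w : Γ ⟶ Z.pt) :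
    eval₀ (0 : Z ⟶ (L P).X) s v w = 0 := by
  unfold eval₀
  split_ifs
  · exact zero_eval s v w
  · exact comp_zero w

theorem eval₀_comp_lam (p : Z ⟶ lamObj A) (h : A.X ⟶ B.X) [IsAddMonHom h] {Γ : C} {I : Type}
    (s : Finset I) (v : I → (Γ ⟶ Z.V.X)) (w : Γ ⟶ Z.pt) :
    eval₀ (p ≫ lam h) s v w = eval₀ p s v w ≫ h := by
  unfold eval₀
  split_ifs
  · exact eval_comp_lam p h s v w
  · exact (Category.assoc _ _ _).symm

/-- The value attached to a block `B` of a partition of a finite set of variables together with one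
marked point `none`: the derivatives of `p` or of `q` in the variables in `B`, according to whether
`B` contains the marked point or not. -/
def markVal (p : Z ⟶ lamObj P.V) (q : Z ⟶ P) {Γ : C} {I : Type} [DecidableEq I]
    (v : I → (Γ ⟶ Z.V.X)) (w : Γ ⟶ Z.pt) (B : Finset (Option I)) : Γ ⟶ P.V.X :=
  if none ∈ B then eval₀ p B.eraseNone v w else Hom.eval q B.eraseNone v w

theorem markVal_insertNone (p : Z ⟶ lamObj P.V) (q : Z ⟶ P) {Γ : C} {I : Type} [DecidableEq I]
    (v : I → (Γ ⟶ Z.V.X)) (w : Γ ⟶ Z.pt) (B : Finset I) :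
    markVal p q v w (Finset.insertNone B) = eval₀ p B v w := by
  simp [markVal]

theorem markVal_map_some (p : Z ⟶ lamObj P.V) (q : Z ⟶ P) {Γ : C} {I : Type} [DecidableEq I]
    (v : I → (Γ ⟶ Z.V.X)) (w : Γ ⟶ Z.pt) (B : Finset I) :
    markVal p q v w (B.map Function.Embedding.some) = Hom.eval q B v w := by
  simp [markVal]

theorem markVal_mergeBlock (p : Z ⟶ lamObj P.V) (q : Z ⟶ P) {Γ : C} {I : Type} [DecidableEq I]
    (v : I → (Γ ⟶ Z.V.X)) (w : Γ ⟶ Z.pt) {z : Option (Finset I) × Option (Fin 1)}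
    (hz : z.1 ≠ some ∅) :
    blockVal (fun B _ => Hom.eval p B v w) (fun B => Hom.eval q B v w)
      (fun _ => w ≫ Hom.base p) z = markVal p q v w (mergeBlock z) := by
  obtain ⟨_ | B, _ | j⟩ := z
  · simp [mergeBlock, markVal, blockVal, Hom.eval_empty]
  · simp [mergeBlock, markVal, blockVal, eval₀_empty]
  · have h : mergeBlock (some B, (none : Option (Fin 1))) = B.map Function.Embedding.some := by
      simp [mergeBlock]
    rw [h, markVal_map_some]
    rfl
  · have h : mergeBlock (some B, some j) = Finset.insertNone B := by
      ext x
      cases x <;> simp [mergeBlock]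
    have hB : B.Nonempty := Finset.nonempty_iff_ne_empty.2 fun h => hz (by rw [h])
    rw [h, markVal_insertNone, eval₀_of_nonempty p hB]
    rfl

/-- The derivatives of `⟨p, q⟩ D(f)`: the variables together with one marked point, the direction of
the derivative `D(f)`, are partitioned, and `f` is applied to the blocks. -/
theorem eval₀_lift_D (f : P ⟶ Q) (p : Z ⟶ lamObj P.V) (q : Z ⟶ P) {Γ : C} {I : Type}
    [DecidableEq I] (s : Finset I) (v : I → (Γ ⟶ Z.V.X)) (w : Γ ⟶ Z.pt) :
    eval₀ (lift p q ≫ D f) s v w = ∑ σ : Finpartition (Finset.insertNone s),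
      Hom.eval f σ.parts (markVal p q v w) (w ≫ Hom.base q) := by
  have hmatch : ∀ π : Finpartition s, ∀ T ∈ matchings π.parts (Finset.univ : Finset (Fin 1)),
      Hom.eval f T (blockVal (fun B _ => Hom.eval p B v w) (fun B => Hom.eval q B v w)
          (fun _ => w ≫ Hom.base p)) (w ≫ Hom.base q) =
        Hom.eval f (T.image mergeBlock) (markVal p q v w) (w ≫ Hom.base q) := by
    intro π T hT
    rw [Hom.eval_image f mergeBlock (mergeBlock_injOn hT)]
    exact Hom.eval_congr f _ fun z hz => markVal_mergeBlock p q v w (fst_ne_some_empty hT hz)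
  rcases s.eq_empty_or_nonempty with rfl | hs
  · rw [eval₀_empty]
    have ha : IsAtom (Finset.insertNone (∅ : Finset I)) := Finset.isAtom_singleton none
    let _ := IsAtom.uniqueFinpartition (P := ⊥) ha
    rw [Fintype.sum_unique]
    refine (congrArg (fun z => w ≫ z) (vlift_deltaPart_base f 1 one_pos (fun _ => p) q)).trans ?_
    have hparts : (default : Finpartition (Finset.insertNone (∅ : Finset I))).parts =
        {Finset.insertNone ∅} := rfl
    rw [hparts, Hom.eval_singleton, markVal_insertNone, eval₀_empty]
    refine (Category.assoc _ _ _).symm.trans (congrArg (fun z => z ≫ Hom.part f 1 one_pos) ?_)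
    exact comp_lift _ _ _
  · rw [eval₀_of_nonempty _ hs,
      ← sum_matchings_one s fun T => Hom.eval f T (markVal p q v w) (w ≫ Hom.base q)]
    refine (vlift_deltaPart_eval f 1 one_pos (fun _ => p) q s hs v w).trans ?_
    exact Finset.sum_congr rfl fun π _ => Finset.sum_congr rfl (hmatch π)

/-- Two morphisms out of `L₀(P) × P` to some `((A, +, 0), A)` are equal if their composites with all
`⟨p, q⟩` have the same values. -/
theorem ext_lift_eval₀ {g h : (L P).X ⊗ P ⟶ lamObj A}
    (H : ∀ (Z : Faa C) (p : Z ⟶ (L P).X) (q : Z ⟶ P) (Γ : C) (n : ℕ) (v : Fin n → (Γ ⟶ Z.V.X))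
      (w : Γ ⟶ Z.pt), eval₀ (lift p q ≫ g) Finset.univ v w =
        eval₀ (lift p q ≫ h) Finset.univ v w) : g = h := by
  have := ext_eval₀ (H _ (fst _ _) (snd _ _))
  simpa only [lift_fst_snd, Category.id_comp] using this

theorem sum_linear_eval (u : P.pt ⟶ Q.pt) (h : P.V.X ⟶ Q.V.X) [IsAddMonHom h] {Γ : C} {I : Type}
    [DecidableEq I] {s : Finset I} (hs : s.Nonempty) (F : Finset I → (Γ ⟶ P.V.X))
    (x : Γ ⟶ P.pt) :
    ∑ σ : Finpartition s, (linear u h).eval σ.parts F x = F s ≫ h := by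
  rw [Finset.sum_eq_single (Finpartition.indiscrete hs.ne_empty)]
  · exact linear_eval_singleton u h s _ _
  · intro π _ hπ
    refine linear_eval_ne_one _ _ _ (fun hc => hπ ?_) _ _
    obtain ⟨B, hB⟩ := Finset.card_eq_one.1 hc
    obtain rfl : B = s := by
      have := π.sup_parts
      rwa [hB, Finset.sup_singleton] at this
    exact Finpartition.ext hB
  · exact fun h => absurd (Finset.mem_univ _) h

/-- The derivative of a linear morphism `(u, π₀ h, 0, 0, …)` does not depend on the point. -/
theorem D_linear (u : P.pt ⟶ Q.pt) (h : P.V.X ⟶ Q.V.X) [IsAddMonHom h] :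
    D (P := P) (Q := Q) (linear u h) = fst (L P).X P ≫ lam h := by
  refine ext_lift_eval₀ fun Z p q Γ n v w => ?_
  rw [eval₀_lift_D, sum_linear_eval u h ⟨none, Finset.none_mem_insertNone⟩, markVal_insertNone,
    lift_fst_assoc, eval₀_comp_lam]

/-- The chain rule: both sides are sums over the partitions of the variables and the marked point into
blocks, together with a partition of the set of blocks. -/
theorem D_comp (f : P ⟶ Q) (g : Q ⟶ R) : D (f ≫ g) = lift (D f) (snd _ _ ≫ f) ≫ D g := by
  refine ext_lift_eval₀ fun Z p q Γ n v w => ?_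
  have hpq : lift p q ≫ lift (D f) (snd _ _ ≫ f) ≫ D g =
      lift (lift p q ≫ D f) (q ≫ f) ≫ D g := by
    rw [← Category.assoc, comp_lift, lift_snd_assoc]
  rw [hpq, eval₀_lift_D, eval₀_lift_D]
  have hfg : ∀ σ : Finpartition (Finset.insertNone (Finset.univ : Finset (Fin n))),
      Hom.eval (f ≫ g) σ.parts (markVal p q v w) (w ≫ Hom.base q) =
        ∑ ρ : Finpartition σ.parts, Hom.eval g ρ.parts
          (fun T => Hom.eval f T (markVal p q v w) (w ≫ Hom.base q))
          ((w ≫ Hom.base q) ≫ Hom.base f) := fun σ => eval_comp f g _ _ _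
  have hblock : ∀ B : Finset (Option (Fin n)),
      markVal (P := Q) (lift p q ≫ D f) (q ≫ f) v w B =
        ∑ φ : Finpartition B, Hom.eval f φ.parts (markVal p q v w) (w ≫ Hom.base q) := by
    intro B
    by_cases hB : none ∈ B
    · obtain ⟨B, rfl⟩ : ∃ B', B = Finset.insertNone B' :=
        ⟨B.eraseNone, by rw [Finset.insertNone_eraseNone, Finset.insert_eq_of_mem hB]⟩
      rw [markVal_insertNone, eval₀_lift_D]
    · obtain ⟨B, rfl⟩ : ∃ B' : Finset (Fin n), B = B'.map Function.Embedding.some :=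
        ⟨B.eraseNone, by rw [Finset.map_some_eraseNone, Finset.erase_eq_of_notMem hB]⟩
      rw [markVal_map_some, sum_finpartition_map Function.Embedding.some B fun T =>
        Hom.eval f T (markVal p q v w) (w ≫ Hom.base q)]
      refine (eval_comp q f B v w).trans (Finset.sum_congr rfl fun φ _ => ?_)
      rw [Hom.eval_map]
      exact Hom.eval_congr f _ fun B' _ => (markVal_map_some p q v w B').symm
  simp only [hfg]
  rw [← sum_partition_assoc (Finset.insertNone Finset.univ) fun T => Hom.eval g T
    (fun T => Hom.eval f T (markVal p q v w) (w ≫ Hom.base q)) ((w ≫ Hom.base q) ≫ Hom.base f)]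
  refine Finset.sum_congr rfl fun σ _ => ?_
  rw [funext hblock, eval_sum g σ.parts (κ := fun B => Finpartition B)
    fun B φ => Hom.eval f φ.parts (markVal p q v w) (w ≫ Hom.base q)]
  refine Finset.sum_congr rfl fun φ _ => ?_
  rw [Hom.eval_image]
  · exact congrArg (Hom.eval g _ _) (Category.assoc _ _ _)
  · intro B₁ _ B₂ _ hB
    apply Subtype.ext
    rw [← (φ B₁).sup_parts, ← (φ B₂).sup_parts]
    exact congrArg (fun p => Finset.sup p id) hB

end Faa
end Jets

/-! ### The second derivative -/

section SecondDerivative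

variable {C : Type u} [Category.{v} C] [CartesianMonoidalCategory C] [BraidedCategory C]

namespace Faa

open Hom

variable {P Q Z : Faa C}

/-- The morphism `⟨a, b⟩ : Z ⟶ L₀(L₀(P) × P) = L₀(P) × L₀(P)`. -/
abbrev liftVec (a b : Z ⟶ (L P).X) : Z ⟶ (L ((L P).X ⊗ P)).X := lift a b

theorem eval₁_proj₁ {Γ : C} (b : Γ ⟶ P.V.X) (c : Γ ⟶ Q.V.X) (x : Γ ⟶ (P.prod Q).pt) :
    (proj₁ P Q).eval₁ (lift b c) x = b :=
  (lift_fst_assoc (lift b c) x (fst P.V.X Q.V.X)).trans (lift_fst b c)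

theorem eval₁_proj₂ {Γ : C} (b : Γ ⟶ P.V.X) (c : Γ ⟶ Q.V.X) (x : Γ ⟶ (P.prod Q).pt) :
    (proj₂ P Q).eval₁ (lift b c) x = c :=
  (lift_fst_assoc (lift b c) x (snd P.V.X Q.V.X)).trans (lift_snd b c)

/-- The derivatives of `D(f)`, in terms of the components of the vectors in `L₀(P) × P`. -/
theorem eval_D (f : P ⟶ Q) {Γ : C} {I : Type} [DecidableEq I] {s : Finset I} (hs : s.Nonempty)
    (b c : I → (Γ ⟶ P.V.X)) (y : Γ ⟶ P.V.X) (z : Γ ⟶ P.pt) :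
    Hom.eval (P := (L P).X ⊗ P) (Q := (L Q).X) (D f) s (fun i => lift (b i) (c i)) (lift y z) =
      ∑ T ∈ matchings s (Finset.univ : Finset (Fin 1)),
        Hom.eval f T (blockVal (fun i _ => b i) c (fun _ => y)) z := by
  change Hom.eval (P := vec (lamObj P.V) P 1) (Q := lamObj Q.V) (f.deltaPart 1 one_pos) s _ _ = _
  refine (ofFamily_eval (P := vec (lamObj P.V) P 1) (Q := lamObj Q.V) _ _ _ _ _ _ s hs
    _ _).trans ?_
  have hz : lift y z ≫ Hom.base (vbase (lamObj P.V) P 1) = z :=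
    (congrArg (fun k => lift y z ≫ k) (Category.comp_id _)).trans (lift_snd y z)
  refine Finset.sum_congr rfl fun T _ => ((Hom.eval_congr f _ fun p _ => ?_).trans
    (congrArg (fun k => Hom.eval f T _ k) hz))
  have hfst : ∀ j i, eval₁ (vproj (lamObj P.V) P 1 j) (lift (b i) (c i)) (lift y z) = b i := by
    intro j i
    obtain rfl := Fin.fin_one_eq_zero j
    exact eval₁_proj₁ (P := lamObj P.V) (Q := P) (b i) (c i) (lift y z)
  have hsnd : ∀ i, eval₁ (vbase (lamObj P.V) P 1) (lift (b i) (c i)) (lift y z) = c i := by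
    intro i
    have h : vbase (lamObj P.V) P 1 = proj₂ (lamObj P.V) P := Category.comp_id (snd (lamObj P.V) P)
    refine (congrArg (fun k => eval₁ k (lift (b i) (c i)) (lift y z)) h).trans ?_
    exact eval₁_proj₂ (P := lamObj P.V) (Q := P) (b i) (c i) (lift y z)
  have hpt : ∀ j, lift y z ≫ Hom.base (vproj (lamObj P.V) P 1 j) = y := by
    intro j
    obtain rfl := Fin.fin_one_eq_zero j
    exact lift_fst y z
  obtain ⟨x, y'⟩ := p
  cases x <;> cases y'
  · rfl
  · exact hpt _
  · exact hsnd _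
  · exact hfst _ _

theorem eval₀_liftVec (a b : Z ⟶ (L P).X) {Γ : C} {I : Type} (s : Finset I)
    (v : I → (Γ ⟶ Z.V.X)) (w : Γ ⟶ Z.pt) :
    eval₀ (liftVec a b) s v w = lift (eval₀ a s v w) (eval₀ b s v w) := by
  unfold eval₀
  split_ifs
  · exact pair_eval a b s v w
  · exact comp_lift w _ _

theorem markVal_liftVec (a b c : Z ⟶ (L P).X) (d : Z ⟶ P) {Γ : C} {I : Type} [DecidableEq I]
    (v : I → (Γ ⟶ Z.V.X)) (w : Γ ⟶ Z.pt) (B : Finset (Option I)) :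
    markVal (P := (L P).X ⊗ P) (liftVec a b) (lift c d) v w B =
      lift (markVal (P := (L P).X) a c v w B) (markVal b d v w B) := by
  unfold markVal
  split_ifs
  · exact eval₀_liftVec a b _ v w
  · exact pair_eval c d _ v w

/-- The derivatives of `⟨⟨a, b⟩, ⟨c, d⟩⟩ D(D(f))`: `eval₀_lift_D` for the outer differentiation, and the
definition of `δ(f)₁` for the inner one. -/
theorem eval₀_lift_D_D (f : P ⟶ Q) (a b c : Z ⟶ (L P).X) (d : Z ⟶ P) {Γ : C} {I : Type}
    [DecidableEq I] (s : Finset I) (v : I → (Γ ⟶ Z.V.X)) (w : Γ ⟶ Z.pt) :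
    eval₀ (A := Q.V) (lift (liftVec a b) (lift c d) ≫
        D (P := (L P).X ⊗ P) (Q := (L Q).X) (D f)) s v w =
      ∑ π : Finpartition (Finset.insertNone s),
        ∑ T ∈ matchings π.parts (Finset.univ : Finset (Fin 1)),
          Hom.eval f T (blockVal (fun B _ => markVal (P := (L P).X) a c v w B)
            (fun B => markVal b d v w B) (fun _ => w ≫ Hom.base c)) (w ≫ Hom.base d) := by
  refine (eval₀_lift_D (P := (L P).X ⊗ P) (Q := (L Q).X) (D f) (liftVec a b) (lift c d) s v w).trans
    (Finset.sum_congr rfl fun π _ => ?_)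
  rw [funext (markVal_liftVec a b c d v w)]
  have hw : w ≫ Hom.base (lift c d) = lift (w ≫ Hom.base c) (w ≫ Hom.base d) := comp_lift w _ _
  rw [hw]
  exact eval_D f (π.parts_nonempty (Finset.nonempty_iff_ne_empty.1
    ⟨none, Finset.none_mem_insertNone⟩)) _ _ _ _

end Faa
end SecondDerivative

/-! ### The axioms for the second derivative -/

section SecondDerivativeAxioms

/-- The matching of `t` with a one-element set in which `j₀` is matched. -/
def matchOne {J : Type} [DecidableEq J] (t : Finset J) (j₀ : J) :
    Finset (Option J × Option (Fin 1)) :=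
  t.image fun j => (some j, if j = j₀ then some 0 else none)

theorem matchOne_mem_matchings {J : Type} [DecidableEq J] {t : Finset J} {j₀ : J} (hj₀ : j₀ ∈ t) :
    matchOne t j₀ ∈ matchings t (Finset.univ : Finset (Fin 1)) := by
  refine mem_matchings.2 ⟨?_, ?_, ?_, ?_⟩
  · intro p hp
    obtain ⟨j, hj, rfl⟩ := Finset.mem_image.1 hp
    exact Finset.mem_product.2 ⟨Finset.some_mem_insertNone.2 hj,
      Finset.mem_insertNone.2 fun _ _ => Finset.mem_univ _⟩
  · intro h
    obtain ⟨j, -, hj⟩ := Finset.mem_image.1 h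
    simp at hj
  · intro j hj
    refine ⟨_, ⟨Finset.mem_image_of_mem _ hj, rfl⟩, ?_⟩
    rintro p ⟨hp, hpj⟩
    obtain ⟨k, -, rfl⟩ := Finset.mem_image.1 hp
    obtain rfl := Option.some.inj hpj
    rfl
  · intro i _
    obtain rfl := Fin.fin_one_eq_zero i
    refine ⟨_, ⟨Finset.mem_image_of_mem _ hj₀, if_pos rfl⟩, ?_⟩
    rintro p ⟨hp, hpj⟩
    obtain ⟨k, -, rfl⟩ := Finset.mem_image.1 hp
    obtain rfl : k = j₀ := by
      by_contra h
      simp [h] at hpj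
    rfl

theorem eq_matchOne {J : Type} [DecidableEq J] {t : Finset J} {j₀ : J}
    {T : Finset (Option J × Option (Fin 1))} (hT : T ∈ matchings t (Finset.univ : Finset (Fin 1)))
    (h : (some j₀, some 0) ∈ T) : T = matchOne t j₀ := by
  obtain ⟨hsub, hnn, h1, h2⟩ := mem_matchings.1 hT
  have hu : ∀ p ∈ T, p.2 = some 0 → p = (some j₀, some 0) := fun p hp hp0 =>
    (h2 0 (Finset.mem_univ _)).unique ⟨hp, hp0⟩ ⟨h, rfl⟩
  have hmem : ∀ p ∈ T, ∃ j ∈ t, p = (some j, if j = j₀ then some 0 else none) := by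
    rintro ⟨x, y⟩ hp
    cases y with
    | some i =>
      obtain rfl := Fin.fin_one_eq_zero i
      have hj₀ := Finset.some_mem_insertNone.1 (Finset.mem_product.1 (hsub h)).1
      exact ⟨j₀, hj₀, by rw [hu _ hp rfl, if_pos rfl]⟩
    | none =>
      cases x with
      | none => exact absurd hp hnn
      | some j =>
        have hj := Finset.some_mem_insertNone.1 (Finset.mem_product.1 (hsub hp)).1
        refine ⟨j, hj, ?_⟩
        have hne : j ≠ j₀ := by
          rintro rfl
          have := (h1 j hj).unique ⟨hp, rfl⟩ ⟨h, rfl⟩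
          simp at this
        rw [if_neg hne]
  ext p
  constructor
  · intro hp
    obtain ⟨j, hj, rfl⟩ := hmem p hp
    exact Finset.mem_image_of_mem _ hj
  · intro hp
    obtain ⟨j, hj, rfl⟩ := Finset.mem_image.1 hp
    obtain ⟨q, ⟨hq, hqj⟩, -⟩ := h1 j hj
    obtain ⟨k, -, rfl⟩ := hmem q hq
    obtain rfl := Option.some.inj hqj
    exact hq

variable {C : Type u} [Category.{v} C] [CartesianMonoidalCategory C] [BraidedCategory C]

namespace Faa

open Hom

variable {P Q Z : Faa C}

/-- The second derivative along `⟨a, 0⟩` is the first derivative along `a`. -/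
theorem lift_D_D_zero (f : P ⟶ Q) (a c : Z ⟶ (L P).X) (d : Z ⟶ P) :
    lift (liftVec a 0) (lift c d) ≫ D (P := (L P).X ⊗ P) (Q := (L Q).X) (D f) =
      lift a d ≫ D f := by
  refine ext_eval₀ (A := Q.V) fun Γ n v w => ?_
  rw [eval₀_lift_D_D, eval₀_lift_D]
  refine Finset.sum_congr rfl fun π _ => ?_
  obtain ⟨B₀, hB₀, hn⟩ := π.exists_mem (Finset.none_mem_insertNone (s := Finset.univ))
  rw [Finset.sum_eq_single (matchOne π.parts B₀)]
  · rw [matchOne, Hom.eval_image]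
    · refine Hom.eval_congr f _ fun B hB => ?_
      by_cases h : B = B₀
      · subst h
        rw [if_pos rfl]
        exact (if_pos hn).trans (if_pos hn).symm
      · rw [if_neg h]
        have hnB : none ∉ B := fun hnB => h (π.eq_of_mem_parts hB hB₀ hnB hn)
        exact (if_neg hnB).trans (if_neg hnB).symm
    · intro B _ B' _ h
      exact Option.some.inj (congrArg Prod.fst h)
  -- A term in which the block `B₀` of the marked point is unmatched has an argument `0`.
  · intro T hT hne
    obtain ⟨y, hy, -⟩ := exists_block hT hB₀
    cases y with
    | none =>
      exact f.eval_eq_zero hy _ ((if_pos hn).trans (eval₀_zero _ v w))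
    | some j =>
      obtain rfl := Fin.fin_one_eq_zero j
      exact absurd (eq_matchOne hT hy) hne
  · exact fun h => absurd (matchOne_mem_matchings hB₀) h

/-- The value attached to a block `B` of a partition of a finite set of variables together with two
marked points `none` and `some none`: the derivatives of `a`, `b`, `c` or `d` in the variables in
`B`, according to whether `B` contains both marked points, only `some none`, only `none`, or
neither. -/
def markVal₂ (a b c : Z ⟶ lamObj P.V) (d : Z ⟶ P) {Γ : C} {I : Type} [DecidableEq I]
    (v : I → (Γ ⟶ Z.V.X)) (w : Γ ⟶ Z.pt) (B : Finset (Option (Option I))) : Γ ⟶ P.V.X :=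
  if none ∈ B then
    if some none ∈ B then eval₀ a B.eraseNone.eraseNone v w else eval₀ c B.eraseNone.eraseNone v w
  else
    if some none ∈ B then eval₀ b B.eraseNone.eraseNone v w
    else Hom.eval d B.eraseNone.eraseNone v w

theorem markVal₂_insertNone (a b c : Z ⟶ (L P).X) (d : Z ⟶ P) {Γ : C} {I : Type} [DecidableEq I]
    (v : I → (Γ ⟶ Z.V.X)) (w : Γ ⟶ Z.pt) {B : Finset (Option I)} (hB : B.Nonempty) :
    markVal₂ a b c d v w (Finset.insertNone B) = markVal (P := (L P).X) a c v w B := by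
  simp only [markVal₂, markVal, Finset.none_mem_insertNone, Finset.some_mem_insertNone,
    Finset.eraseNone_insertNone, if_true]
  by_cases hn : none ∈ B
  · rw [if_pos hn, if_pos hn]
  · rw [if_neg hn, if_neg hn]
    refine eval₀_of_nonempty c ?_ v w
    obtain ⟨_ | i, hi⟩ := hB
    · exact absurd hi hn
    · exact ⟨i, Finset.mem_eraseNone.2 hi⟩

theorem markVal₂_map_some (a b c : Z ⟶ (L P).X) (d : Z ⟶ P) {Γ : C} {I : Type} [DecidableEq I]
    (v : I → (Γ ⟶ Z.V.X)) (w : Γ ⟶ Z.pt) (B : Finset (Option I)) :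
    markVal₂ a b c d v w (B.map Function.Embedding.some) = markVal b d v w B := by
  simp [markVal₂, markVal]

theorem markVal₂_mergeBlock (a b c : Z ⟶ (L P).X) (d : Z ⟶ P) {Γ : C} {I : Type} [DecidableEq I]
    (v : I → (Γ ⟶ Z.V.X)) (w : Γ ⟶ Z.pt) {z : Option (Finset (Option I)) × Option (Fin 1)}
    (hz : z.1 ≠ some ∅) :
    blockVal (fun B _ => markVal (P := (L P).X) a c v w B) (fun B => markVal b d v w B)
      (fun _ => w ≫ Hom.base c) z = markVal₂ a b c d v w (mergeBlock z) := by
  obtain ⟨_ | B, _ | j⟩ := z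
  · simp [mergeBlock, markVal₂, blockVal, Hom.eval_empty]
  · simp [mergeBlock, markVal₂, blockVal, eval₀_empty]
  · have h : mergeBlock (some B, (none : Option (Fin 1))) = B.map Function.Embedding.some := by
      simp [mergeBlock]
    rw [h, markVal₂_map_some]
    rfl
  · have h : mergeBlock (some B, some j) = Finset.insertNone B := by
      ext x
      cases x <;> simp [mergeBlock]
    have hB : B.Nonempty := Finset.nonempty_iff_ne_empty.2 fun h => hz (by rw [h])
    rw [h, markVal₂_insertNone a b c d v w hB]
    rfl

/-- The derivatives of `⟨⟨a, b⟩, ⟨c, d⟩⟩ D(D(f))`: the variables together with two marked points,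
`some none` for the outer and `none` for the inner differentiation, are partitioned, and `f` is
applied to the blocks. -/
theorem eval₀_lift_D_D_eq_sum (f : P ⟶ Q) (a b c : Z ⟶ (L P).X) (d : Z ⟶ P) {Γ : C} {I : Type}
    [DecidableEq I] (s : Finset I) (v : I → (Γ ⟶ Z.V.X)) (w : Γ ⟶ Z.pt) :
    eval₀ (A := Q.V) (lift (liftVec a b) (lift c d) ≫
        D (P := (L P).X ⊗ P) (Q := (L Q).X) (D f)) s v w =
      ∑ σ : Finpartition (Finset.insertNone (Finset.insertNone s)),
        Hom.eval f σ.parts (markVal₂ a b c d v w) (w ≫ Hom.base d) := by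
  rw [eval₀_lift_D_D, ← sum_matchings_one (Finset.insertNone s) fun T =>
    Hom.eval f T (markVal₂ a b c d v w) (w ≫ Hom.base d)]
  refine Finset.sum_congr rfl fun π _ => Finset.sum_congr rfl fun T hT => ?_
  rw [Hom.eval_image f mergeBlock (mergeBlock_injOn hT)]
  exact Hom.eval_congr f _ fun z hz => markVal₂_mergeBlock a b c d v w (fst_ne_some_empty hT hz)

/-- The exchange of the two added points. -/
def swapNone (I : Type) [DecidableEq I] : Option (Option I) ↪ Option (Option I) :=
  (Equiv.swap none (some none)).toEmbedding

theorem mem_map_swapNone {I : Type} [DecidableEq I] {B : Finset (Option (Option I))}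
    {x : Option (Option I)} : x ∈ B.map (swapNone I) ↔ swapNone I x ∈ B := by
  rw [swapNone, Finset.mem_map_equiv, Equiv.symm_swap]
  rfl

theorem swapNone_none {I : Type} [DecidableEq I] : swapNone I none = some none :=
  Equiv.swap_apply_left _ _

theorem swapNone_some_none {I : Type} [DecidableEq I] : swapNone I (some none) = none :=
  Equiv.swap_apply_right _ _

theorem swapNone_some_some {I : Type} [DecidableEq I] (i : I) :
    swapNone I (some (some i)) = some (some i) :=
  Equiv.swap_apply_of_ne_of_ne (by simp) (by simp)

theorem map_swapNone_insertNone {I : Type} [DecidableEq I] (s : Finset I) :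
    (Finset.insertNone (Finset.insertNone s)).map (swapNone I) =
      Finset.insertNone (Finset.insertNone s) := by
  ext x
  rw [mem_map_swapNone]
  obtain _ | _ | i := x
  · simp [swapNone_none]
  · simp [swapNone_some_none]
  · rw [swapNone_some_some]

theorem markVal₂_map_swapNone (a b c : Z ⟶ (L P).X) (d : Z ⟶ P) {Γ : C} {I : Type}
    [DecidableEq I] (v : I → (Γ ⟶ Z.V.X)) (w : Γ ⟶ Z.pt) (B : Finset (Option (Option I))) :
    markVal₂ a b c d v w (B.map (swapNone I)) = markVal₂ a c b d v w B := by
  have h : (B.map (swapNone I)).eraseNone.eraseNone = B.eraseNone.eraseNone := by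
    ext i
    simp only [Finset.mem_eraseNone, mem_map_swapNone, swapNone_some_some]
  simp only [markVal₂, h, mem_map_swapNone, swapNone_none, swapNone_some_none]
  split_ifs <;> rfl

/-- The symmetry of the second derivative. -/
theorem lift_D_D_symm (f : P ⟶ Q) (a b c : Z ⟶ (L P).X) (d : Z ⟶ P) :
    lift (liftVec a b) (lift c d) ≫ D (P := (L P).X ⊗ P) (Q := (L Q).X) (D f) =
      lift (liftVec a c) (lift b d) ≫ D (P := (L P).X ⊗ P) (Q := (L Q).X) (D f) := by
  refine ext_eval₀ (A := Q.V) fun Γ n v w => ?_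
  rw [eval₀_lift_D_D_eq_sum, eval₀_lift_D_D_eq_sum]
  conv_lhs => rw [← map_swapNone_insertNone]
  rw [sum_finpartition_map (swapNone (Fin n)) _ fun T =>
    Hom.eval f T (markVal₂ a b c d v w) (w ≫ Hom.base d)]
  refine Finset.sum_congr rfl fun σ _ => ?_
  rw [Hom.eval_map]
  exact Hom.eval_congr f _ fun B _ => markVal₂_map_swapNone a b c d v w B

end Faa
end SecondDerivativeAxioms

/-! ### The differential structure and its triviality -/

section Structure

variable {C : Type u} [Category.{v} C] [CartesianMonoidalCategory C] [BraidedCategory C]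

/-- The product of two commutative monoids is the only monoid structure on the product of the
underlying objects for which the projections are additive. -/
theorem CMon.mk_eq_prod (A B : CMon C) (i : AddMonObj (A.X ⊗ B.X)) (c : IsCommAddMonObj (A.X ⊗ B.X))
    (h₁ : IsAddMonHom (fst A.X B.X)) (h₂ : IsAddMonHom (snd A.X B.X)) :
    @CMon.mk C _ _ _ (A.X ⊗ B.X) i c = A.prod B := by
  have key : i = (A.prod B).add := by
    refine AddMonObj.ext _ _ (CartesianMonoidalCategory.hom_ext _ _ ?_ ?_)
    · exact h₁.add_hom.trans (@IsAddMonHom.add_hom _ _ _ _ _ (A.prod B).add _ _ inferInstance).symm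
    · exact h₂.add_hom.trans (@IsAddMonHom.add_hom _ _ _ _ _ (A.prod B).add _ _ inferInstance).symm
  subst key
  rfl

theorem CMon.mk_eq_unit (i : AddMonObj (𝟙_ C)) (c : IsCommAddMonObj (𝟙_ C)) :
    @CMon.mk C _ _ _ (𝟙_ C) i c = CMon.unit := by
  have key : i = (CMon.unit : CMon C).add := AddMonObj.ext _ _ (toUnit_unique _ _)
  subst key
  rfl

namespace Faa

open Hom

variable {P Q R Z : Faa C} {A B : CMon C}

instance lam_isAddMonHom (h : A.X ⟶ B.X) [IsAddMonHom h] : IsAddMonHom (lam h) where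
  zero_hom := by
    refine (lam_comp (A := CMon.unit) (B := A) (D := B) _ h).trans (lam_congr ?_)
    exact IsAddMonHom.zero_hom h
  add_hom := by
    have ht : (lam h ⊗ₘ lam h) = lam (A := A.prod A) (B := B.prod B) (h ⊗ₘ h) := by
      rw [MonoidalCategory.tensorHom_def]
      refine (congrArg₂ (fun k l => k ≫ l) (whiskerRight_lam h) (whiskerLeft_lam h)).trans ?_
      refine (lam_comp (A := A.prod A) (B := B.prod A) (D := B.prod B) (h ▷ A.X) (B.X ◁ h)).trans ?_
      exact lam_congr (MonoidalCategory.tensorHom_def h h).symm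
    refine (lam_comp (A := A.prod A) (B := A) (D := B) _ h).trans ?_
    refine Eq.trans (lam_congr ?_) ((congrArg (fun k => k ≫ AddMonObj.add (X := lamObj B)) ht).trans
      (lam_comp (A := A.prod A) (B := B.prod B) (D := B) (h ⊗ₘ h) _)).symm
    exact IsAddMonHom.add_hom h

theorem L_tensor (P Q : Faa C) : L (P ⊗ Q) = (L P).prod (L Q) :=
  CMon.mk_eq_prod (L P) (L Q) (lamAdd (P.V.prod Q.V)) (lamAdd_comm (P.V.prod Q.V))
    (lam_isAddMonHom (A := P.V.prod Q.V) (B := P.V) (fst P.V.X Q.V.X))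
    (lam_isAddMonHom (A := P.V.prod Q.V) (B := Q.V) (snd P.V.X Q.V.X))

theorem L_tensorUnit : L (𝟙_ (Faa C)) = CMon.unit :=
  CMon.mk_eq_unit (lamAdd CMon.unit) (lamAdd_comm CMon.unit)

theorem lift_add_D (f : P ⟶ Q) (a b : Z ⟶ (L P).X) (c : Z ⟶ P) :
    lift (a + b) c ≫ D f = lift a c ≫ D f + lift b c ≫ D f := by
  have h := Hom.part_add (delta f) 1 one_pos Z (fun _ => 0) c 0 a b
  simp only [Function.update_eq_const_of_subsingleton] at h
  exact h

theorem lift_zero_D (f : P ⟶ Q) (c : Z ⟶ P) : lift (0 : Z ⟶ (L P).X) c ≫ D f = 0 := by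
  have h := Hom.part_zero (delta f) 1 one_pos Z (fun _ => 0) c 0
  simp only [Function.update_eq_const_of_subsingleton] at h
  exact h

theorem D_comp_linear (f : P ⟶ Q) (u : Q.pt ⟶ R.pt) (h : Q.V.X ⟶ R.V.X) [IsAddMonHom h] :
    D (f ≫ (linear u h : Q ⟶ R)) = D f ≫ lam h := by
  rw [D_comp, D_linear, lift_fst_assoc]

theorem D_fst (P Q : Faa C) : D (fst P Q) = fst _ _ ≫ fst (L P).X (L Q).X :=
  D_linear (P := P.prod Q) (Q := P) (fst P.pt Q.pt) (fst P.V.X Q.V.X)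

theorem D_snd (P Q : Faa C) : D (snd P Q) = fst _ _ ≫ snd (L P).X (L Q).X :=
  D_linear (P := P.prod Q) (Q := Q) (snd P.pt Q.pt) (snd P.V.X Q.V.X)

theorem D_lift (f : P ⟶ Q) (g : P ⟶ R) :
    D (lift f g) = (lift (D f) (D g) : (L P).X ⊗ P ⟶ (L Q).X ⊗ (L R).X) := by
  refine CartesianMonoidalCategory.hom_ext (X := (L Q).X) (Y := (L R).X) _ _ ?_ ?_
  · rw [lift_fst]
    refine (D_comp_linear (Q := Q.prod R) (lift f g) (fst Q.pt R.pt)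
      (fst Q.V.X R.V.X)).symm.trans ?_
    exact congrArg D (lift_fst f g)
  · rw [lift_snd]
    refine (D_comp_linear (Q := Q.prod R) (lift f g) (snd Q.pt R.pt)
      (snd Q.V.X R.V.X)).symm.trans ?_
    exact congrArg D (lift_snd f g)

theorem D_add (P : Faa C) :
    D (AddMonObj.add (X := (L P).X)) = fst (L ((L P).X ⊗ (L P).X)).X _ ≫
      (AddMonObj.add (X := (L P).X) : (L P).X ⊗ (L P).X ⟶ (L P).X) :=
  D_linear (P := (L P).X.prod (L P).X) (Q := (L P).X) (AddMonObj.add (X := P.V.X))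
    (AddMonObj.add (X := P.V.X))

theorem D_zero (P : Faa C) :
    D (AddMonObj.zero (X := (L P).X)) = fst (L (𝟙_ (Faa C))).X _ ≫
      (AddMonObj.zero (X := (L P).X) : 𝟙_ (Faa C) ⟶ (L P).X) :=
  D_linear (P := unit) (Q := (L P).X) (AddMonObj.zero (X := P.V.X)) (AddMonObj.zero (X := P.V.X))

/-- `Faà(C)` is a generalized Cartesian differential category. The two sides of each equation between
objects have the same underlying object by definition, so all the maps `CMon.cast` are identities. -/
theorem isGenCartDiff : IsGenCartDiff (C := Faa C) L D where
  L_L _ := rfl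
  L_unit := L_tensorUnit
  L_prod := L_tensor
  cd1_add P := (Category.comp_id _).trans ((D_add P).trans
    (congrArg (fun k => fst _ _ ≫ k) (Category.id_comp _).symm))
  cd1_zero P := (Category.comp_id _).trans ((D_zero P).trans
    (congrArg (fun k => fst _ _ ≫ k) (Category.id_comp _).symm))
  cd2_add f _ a b c := lift_add_D f a b c
  cd2_zero f _ a := lift_zero_D f a
  cd3_fst P Q := (D_fst P Q).trans (congrArg (fun k => fst _ _ ≫ k) (Category.id_comp _).symm)
  cd3_snd P Q := (D_snd P Q).trans (congrArg (fun k => fst _ _ ≫ k) (Category.id_comp _).symm)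
  cd4 f g := (Category.comp_id _).trans (D_lift f g)
  cd5 f g := D_comp f g
  cd6 f Z a c d := by
    refine Eq.trans ?_ (lift_D_D_zero f a c d)
    exact congrArg₂ (fun k l => lift k (lift c d) ≫ l) (Category.comp_id _) (Category.comp_id _)
  cd7 {P Q} f Z b c d := by
    have h : ∀ k : Z ⟶ (L P).X ⊗ (L P).X, k ≫ 𝟙 ((L P).X ⊗ (L P).X) = k := Category.comp_id
    refine Eq.trans ?_ ((lift_D_D_symm f 0 b c d).trans ?_)
    · exact congrArg (fun k => lift k (lift c d) ≫ D (D f)) (h _)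
    · exact congrArg (fun k => lift k (lift b d) ≫ D (D f)) (h _).symm

end Faa

end Structure

section Triviality

variable {C : Type u} [Category.{v} C] [CartesianMonoidalCategory C] [BraidedCategory C]

/-- An object with a commutative monoid structure is terminal if all the maps into it are zero. -/
def CMon.isTerminalOfEqZero (A : CMon C) (h : ∀ {Z : C} (p : Z ⟶ A.X), p = 0) :
    Limits.IsTerminal A.X :=
  Limits.IsTerminal.ofUniqueHom (fun _ => 0) fun _ p => h p

namespace Faa

open Hom

/-- A map `p : Z ⟶ A` is the base of a morphism `((1, +, 0), Z) ⟶ ((A, +, 0), A)`. -/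
theorem onlyTrivialCMon_of_vectorsTerminal (h : VectorsTerminal (C := Faa C) L) :
    OnlyTrivialCMon C := by
  intro A
  obtain ⟨t⟩ := h (lamObj A)
  refine ⟨A.isTerminalOfEqZero fun {Z} p => ?_⟩
  have e := t.hom_ext
    (linear (P := ⟨CMon.unit, Z⟩) (Q := lamObj A) p (AddMonObj.zero (X := A.X)))
    (linear (P := ⟨CMon.unit, Z⟩) (Q := lamObj A) 0 (AddMonObj.zero (X := A.X)))
  exact congrArg Hom.base e

theorem vectorsTerminal_of_onlyTrivialCMon (h : OnlyTrivialCMon C) :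
    VectorsTerminal (C := Faa C) L := by
  intro P
  obtain ⟨t⟩ := h P.V
  exact ⟨(L P).isTerminalOfEqZero fun p => Hom.ext (t.hom_ext _ _)
    (funext fun n => funext fun hn => t.hom_ext _ _)⟩

theorem derivativesZero_of_vectorsTerminal (h : VectorsTerminal (C := Faa C) L) :
    DerivativesZero (C := Faa C) L D := fun {_ Q} f => by
  obtain ⟨t⟩ := h Q
  exact t.hom_ext _ _

/-- The derivative of an identity is a projection; if it vanishes, then so do all the maps into
`L₀(P)`. -/
theorem vectorsTerminal_of_derivativesZero (h : DerivativesZero (C := Faa C) L D) :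
    VectorsTerminal (C := Faa C) L := by
  intro P
  refine ⟨(L P).isTerminalOfEqZero fun {Z} p => ?_⟩
  have h1 : D (𝟙 (L P).X) = fst (L P).X (L P).X ≫ lam (𝟙 P.V.X) :=
    D_linear (P := (L P).X) (Q := (L P).X) (𝟙 P.V.X) (𝟙 P.V.X)
  have h2 : lam (𝟙 P.V.X) = 𝟙 (lamObj P.V) := rfl
  have h3 : D (𝟙 (L P).X) = toUnit _ ≫ AddMonObj.zero (X := (L P).X) := h (𝟙 (L P).X)
  rw [h3, h2, Category.comp_id] at h1
  calc p = lift p 0 ≫ fst (L P).X (L P).X := (lift_fst _ _).symm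
    _ = lift p 0 ≫ toUnit _ ≫ AddMonObj.zero (X := (L P).X) := by rw [← h1]
    _ = 0 := comp_zero (A := (L P).X) (lift p 0)

end Faa

end Triviality

end FaaDiBruno

end

/-- For every Cartesian category `C`, the category `Faà(C)`, with `L(P)` the commutative monoid part
of `δ(P)` and `D(f) = [δ(f)]₁`, is a generalized Cartesian differential category. Its differential
structure is trivial if and only if `1` is the only commutative monoid in `C`; otherwise some
`L₀(P)` is not terminal and some derivative `D(f)` is not zero. -/
theorem mainTheorem4 {C : Type u} [Category.{v} C] [CartesianMonoidalCategory C]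
    [BraidedCategory C] :
    FaaDiBruno.IsGenCartDiff (C := FaaDiBruno.Faa C) FaaDiBruno.Faa.L FaaDiBruno.Faa.D ∧
    (FaaDiBruno.IsTrivialDiff (C := FaaDiBruno.Faa C) FaaDiBruno.Faa.L FaaDiBruno.Faa.D ↔
      FaaDiBruno.OnlyTrivialCMon C) ∧
    (¬ FaaDiBruno.OnlyTrivialCMon C →
      ¬ FaaDiBruno.VectorsTerminal (C := FaaDiBruno.Faa C) FaaDiBruno.Faa.L ∧
      ¬ FaaDiBruno.DerivativesZero (C := FaaDiBruno.Faa C) FaaDiBruno.Faa.L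
        FaaDiBruno.Faa.D) := by
  have hiff : FaaDiBruno.VectorsTerminal (C := FaaDiBruno.Faa C) FaaDiBruno.Faa.L ↔
      FaaDiBruno.OnlyTrivialCMon C :=
    ⟨FaaDiBruno.Faa.onlyTrivialCMon_of_vectorsTerminal,
      FaaDiBruno.Faa.vectorsTerminal_of_onlyTrivialCMon⟩
  refine ⟨FaaDiBruno.Faa.isGenCartDiff, ⟨fun h => hiff.1 h.1, fun h => ⟨hiff.2 h, ?_⟩⟩,
    fun h => ⟨fun hv => h (hiff.1 hv), fun hd => h (hiff.1 ?_)⟩⟩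
  · exact FaaDiBruno.Faa.derivativesZero_of_vectorsTerminal (hiff.2 h)
  · exact FaaDiBruno.Faa.vectorsTerminal_of_derivativesZero hd
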